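/- Let $E_6\subset[0,1]$ be the set of all real numbers $$x=[0;a_1,a_2,a_3,\dots]=\cfrac{1}{a_1+\cfrac{1}{a_2+\cfrac{1}{a_3+\cdots}}}$$ given by infinite continued fractions whose digits satisfy $a_n\in\{1,2,3,4,5,6\}$ for every $n\ge 1$. Then the Hausdorff dimension of $E_6$ satisfies $$0.86761917324015-10^{-13}\;\le\;\dim_H E_6\;\le\;0.86761917324015+10^{-13}.$$ In particular $\dim_H E_6>\tfrac{19}{22}$. -/

import Mathlib

open Filter Topology

/-- The infinite regular continued fraction `[0; a 0, a 1, a 2, …]`, with integer part `0`,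
all partial numerators `1` and partial denominators `a 0, a 1, a 2, …`. -/
def digitContFract (a : ℕ → ℕ) : GenContFract ℝ where
  h := 0
  s := Stream'.Seq.ofStream (fun n => ⟨1, (a n : ℝ)⟩)

/-- `cantorE m` is the set of all values `[0; a₁, a₂, …]` (limits of convergents) of infinite
continued fractions whose digits all lie in `{1, …, m}`. -/
def cantorE (m : ℕ) : Set ℝ :=
  {x | ∃ a : ℕ → ℕ, (∀ n, 1 ≤ a n ∧ a n ≤ m) ∧
    Tendsto (fun n => (digitContFract a).convs n) atTop (𝓝 x)}

/-! The set is the limit set of the maps x ↦ 1/(k + 1 + x), and its dimension is the exponent s at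
which the transfer operator L_s f(x) = Σ_k (k + 1 + x)^(-2s) f(1/(k + 1 + x)) has spectral radius
one. No spectral theory is needed: a function f bounded between positive constants proves dim ≤ s if
L_s f ≤ f, and dim ≥ s if f ≤ L_s f.

Compositions of branches are Möbius maps of determinant ±1, so they satisfy an exact product formula
for distances (`wordMap_sub`), and `wordScale`, the square root of the derivative, varies by a
factor of at most 2. Iterating L_s f ≤ f bounds Σ_w |φ_w'|^s uniformly in the word length, and
covering by cylinders gives finite Hausdorff measure (`dimH_cantorE_le`). Iterating f ≤ L_s f keeps
these sums away from zero. For s' < s the sums over long words then exceed 1 even after the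
distortion is paid for, and a Bernoulli measure on blocks gives dim ≥ s' by mass distribution
(`le_dimH_range_of_separated`, `le_dimH_cantorE`).

One polynomial f of degree 24, close to the eigenfunction, serves both endpoints. With x = 1/2 + u
and c = 1/(k + 3/2), each branch contributes terms c^(2s + j) (1 + cu)^(-(2s + j)) with |cu| ≤ 1/4,
so f - L_s f is a Taylor polynomial plus a geometric tail. Its constant coefficient dominates
everything else and fixes the sign. Once the numbers c^(2s) are replaced by one-sided rational
bounds, this is a comparison of integers (`defect_upper`, `defect_lower`). -/

/-- The inverse branch `x ↦ 1 / (k + 1 + x)` of the Gauss map with digit `k + 1`. -/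
noncomputable def branch {m : ℕ} (k : Fin m) (x : ℝ) : ℝ := ((k : ℝ) + 1 + x)⁻¹

/-- The composition of the branches along a word. -/
noncomputable def wordMap {m : ℕ} : (n : ℕ) → (Fin n → Fin m) → ℝ → ℝ
  | 0, _, x => x
  | n + 1, w, x => branch (w 0) (wordMap n (Fin.tail w) x)

/-- The square root of the absolute derivative of `wordMap`. -/
noncomputable def wordScale {m : ℕ} : (n : ℕ) → (Fin n → Fin m) → ℝ → ℝ
  | 0, _, _ => 1
  | n + 1, w, x => wordMap (n + 1) w x * wordScale n (Fin.tail w) x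

/-- An interval mapped into itself by all branches with digits at most `m`. -/
def trapInterval (m : ℕ) : Set ℝ := Set.Icc (1 / ((m : ℝ) + 1)) (((m : ℝ) + 1) / (m + 2))

/-! ### Geometry of the branches and their compositions -/

section Branch

variable {m : ℕ}

lemma trapInterval_pos {x : ℝ} (hx : x ∈ trapInterval m) : 0 < x :=
  lt_of_lt_of_le (by positivity) hx.1

lemma trapInterval_lt_one {x : ℝ} (hx : x ∈ trapInterval m) : x < 1 := by
  refine lt_of_le_of_lt hx.2 ?_
  rw [div_lt_one (by positivity)]
  linarith

lemma digit_succ_le (k : Fin m) : (k : ℝ) + 1 ≤ m := by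
  exact_mod_cast k.2

lemma branch_pos (k : Fin m) {x : ℝ} (hx : 0 ≤ x) : 0 < branch k x := by
  unfold branch; positivity

lemma branch_le_one (k : Fin m) {x : ℝ} (hx : 0 ≤ x) : branch k x ≤ 1 := by
  unfold branch
  apply inv_le_one_of_one_le₀
  have : (0 : ℝ) ≤ k := by positivity
  linarith

lemma le_branch (k : Fin m) {x : ℝ} (hx : 0 ≤ x) (hx1 : x ≤ 1) :
    1 / ((m : ℝ) + 1) ≤ branch k x := by
  unfold branch
  rw [one_div]
  apply inv_anti₀ (by positivity)
  linarith [digit_succ_le k]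

lemma branch_mem_trapInterval (k : Fin m) {x : ℝ} (hx : x ∈ trapInterval m) :
    branch k x ∈ trapInterval m := by
  refine ⟨le_branch k (trapInterval_pos hx).le (trapInterval_lt_one hx).le, ?_⟩
  unfold branch
  rw [inv_le_comm₀ (by have := trapInterval_pos hx; positivity) (by positivity), inv_div]
  have h : ((m : ℝ) + 2) / (m + 1) = 1 + 1 / ((m : ℝ) + 1) := by field_simp; ring
  have := hx.1
  have : (0 : ℝ) ≤ k := by positivity
  linarith

lemma branch_sub (k : Fin m) {x y : ℝ} (hx : 0 ≤ x) (hy : 0 ≤ y) :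
    |branch k x - branch k y| = branch k x * branch k y * |x - y| := by
  have hx' := branch_pos k hx
  have hy' := branch_pos k hy
  have : branch k x - branch k y = branch k x * branch k y * (y - x) := by
    unfold branch at *
    have h1 : (k : ℝ) + 1 + x ≠ 0 := by positivity
    have h2 : (k : ℝ) + 1 + y ≠ 0 := by positivity
    field_simp
    ring
  rw [this, abs_mul, abs_of_pos (mul_pos hx' hy'), abs_sub_comm]

lemma wordMap_mem {n : ℕ} (w : Fin n → Fin m) {x : ℝ} (hx : x ∈ trapInterval m) :
    wordMap n w x ∈ trapInterval m := by
  induction n with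
  | zero => exact hx
  | succ n ih => exact branch_mem_trapInterval _ (ih _)

lemma wordScale_pos {n : ℕ} (w : Fin n → Fin m) {x : ℝ} (hx : x ∈ trapInterval m) :
    0 < wordScale n w x := by
  induction n with
  | zero => exact one_pos
  | succ n ih => exact mul_pos (trapInterval_pos (wordMap_mem w hx)) (ih _)

/-- A Möbius map φ of determinant ±1 satisfies |φ x - φ y|² = |φ' x| |φ' y| |x - y|² exactly, so no
mean value estimate is lost. -/
lemma wordMap_sub {n : ℕ} (w : Fin n → Fin m) {x y : ℝ} (hx : x ∈ trapInterval m)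
    (hy : y ∈ trapInterval m) :
    |wordMap n w x - wordMap n w y| = wordScale n w x * wordScale n w y * |x - y| := by
  induction n with
  | zero => simp [wordMap, wordScale]
  | succ n ih =>
    have h := branch_sub (w 0) (trapInterval_pos (wordMap_mem (Fin.tail w) hx)).le
      (trapInterval_pos (wordMap_mem (Fin.tail w) hy)).le
    simp only [wordMap, wordScale]
    rw [h, ih]
    ring

/-- The contraction ratio of the branches on `trapInterval m`. -/
noncomputable def trapRatio (m : ℕ) : ℝ := ((m : ℝ) + 1) / (m + 2)

lemma trapRatio_pos (m : ℕ) : 0 < trapRatio m := by unfold trapRatio; positivity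

lemma trapRatio_lt_one (m : ℕ) : trapRatio m < 1 := by
  unfold trapRatio
  rw [div_lt_one (by positivity)]
  linarith

lemma wordScale_le {n : ℕ} (w : Fin n → Fin m) {x : ℝ} (hx : x ∈ trapInterval m) :
    wordScale n w x ≤ trapRatio m ^ n := by
  induction n with
  | zero => simp [wordScale]
  | succ n ih =>
    rw [pow_succ', wordScale]
    exact mul_le_mul (wordMap_mem w hx).2 (ih _) (wordScale_pos _ hx).le (trapRatio_pos m).le

/-- In classical terms q and q' are consecutive continuants. The bound q' ≤ q, which controls
distortion, does not propagate alone; p' + q' ≤ p + q is the companion that closes the induction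
and, unlike p' ≤ p, holds for the empty word. -/
lemma exists_wordScale_eq {n : ℕ} (w : Fin n → Fin m) :
    ∃ p p' q q' : ℝ, 0 ≤ p ∧ 0 ≤ p' ∧ 0 < q ∧ 0 ≤ q' ∧ q' ≤ q ∧ p' + q' ≤ p + q ∧
      ∀ x ∈ trapInterval m, wordMap n w x = (p + p' * x) / (q + q' * x) ∧
        wordScale n w x = 1 / (q + q' * x) := by
  induction n with
  | zero => exact ⟨0, 1, 1, 0, by simp [wordMap, wordScale]⟩
  | succ n ih =>
    obtain ⟨p, p', q, q', hp, hp', hq, hq', h1, h2, h⟩ := ih (Fin.tail w)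
    set k : ℝ := ((w 0 : Fin m) : ℝ) with hk
    have hk0 : 0 ≤ k := by positivity
    refine ⟨q, q', (k + 1) * q + p, (k + 1) * q' + p', hq.le, hq', by positivity, by positivity,
      ?_, ?_, ?_⟩
    · nlinarith
    · nlinarith
    · intro x hx
      have hx0 := trapInterval_pos hx
      obtain ⟨e1, e2⟩ := h x hx
      have hd : 0 < q + q' * x := by positivity
      have hd' : 0 < (k + 1) * q + p + ((k + 1) * q' + p') * x := by positivity
      have key : wordMap (n + 1) w x = (q + q' * x) / ((k + 1) * q + p + ((k + 1) * q' + p') * x) := by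
        rw [wordMap, branch, e1, ← hk, inv_eq_one_div, div_eq_div_iff _ hd'.ne']
        · field_simp
          ring
        · positivity
      refine ⟨key, ?_⟩
      rw [wordScale, key, e2]
      field_simp

/-- Bounded distortion: q + q' y ≤ 2q ≤ 2(q + q' x), since q' ≤ q and y < 1. -/
lemma wordScale_le_two_mul {n : ℕ} (w : Fin n → Fin m) {x y : ℝ} (hx : x ∈ trapInterval m)
    (hy : y ∈ trapInterval m) : wordScale n w x ≤ 2 * wordScale n w y := by
  obtain ⟨p, p', q, q', hp, hp', hq, hq', h1, h2, h⟩ := exists_wordScale_eq w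
  have hx0 := trapInterval_pos hx
  have hy0 := trapInterval_pos hy
  have hy1 := trapInterval_lt_one hy
  rw [(h x hx).2, (h y hy).2, mul_one_div, div_le_div_iff₀ (by positivity) (by positivity)]
  nlinarith [mul_nonneg hq' hx0.le]

lemma measurable_wordMap {n : ℕ} (w : Fin n → Fin m) : Measurable (wordMap n w) := by
  induction n with
  | zero => exact measurable_id
  | succ n ih => exact (measurable_const.add (ih _)).inv

/-- The images of [0, 1] under neighbouring branches touch. Inside `trapInterval m` points differ by
at most 1 - 1/(m + 1), less than the gap 1 between digits, so the images are separated. -/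
lemma exists_le_abs_branch_sub (m : ℕ) : ∃ δ > 0, ∀ k l : Fin m, k ≠ l →
    ∀ x ∈ trapInterval m, ∀ y ∈ trapInterval m, δ ≤ |branch k x - branch l y| := by
  have ha : 0 < 1 / ((m : ℝ) + 1) := by positivity
  refine ⟨(1 / ((m : ℝ) + 1)) ^ 3, by positivity, fun k l hkl x hx y hy => ?_⟩
  have hx0 := trapInterval_pos hx
  have hy0 := trapInterval_pos hy
  have hx1 := trapInterval_lt_one hx
  have hy1 := trapInterval_lt_one hy
  have e : branch k x - branch l y =
      branch k x * branch l y * (((l : ℝ) - k) + (y - x)) := by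
    unfold branch
    field_simp
    ring
  have h1 := le_branch k hx0.le hx1.le
  have h2 := le_branch l hy0.le hy1.le
  have hd : (1 : ℝ) ≤ |(l : ℝ) - k| := by
    have : (1 : ℤ) ≤ |((l : ℕ) : ℤ) - ((k : ℕ) : ℤ)| := by
      apply Int.one_le_abs
      intro h
      apply hkl
      apply Fin.ext
      omega
    exact_mod_cast this
  have hxy : |y - x| ≤ 1 - 1 / ((m : ℝ) + 1) := by
    rw [abs_le]
    constructor <;> linarith [hx.1, hy.1]
  have h3 : 1 / ((m : ℝ) + 1) ≤ |((l : ℝ) - k) + (y - x)| := by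
    have := abs_sub_abs_le_abs_sub ((l : ℝ) - k) (-(y - x))
    rw [abs_neg, sub_neg_eq_add] at this
    linarith
  have hk := branch_pos k hx0.le
  have hl := branch_pos l hy0.le
  rw [e, abs_mul, abs_of_pos (mul_pos hk hl), pow_succ, sq]
  gcongr

lemma exists_le_abs_wordMap_sub (m n : ℕ) : ∃ δ > 0, ∀ v w : Fin n → Fin m, v ≠ w →
    ∀ x ∈ trapInterval m, ∀ y ∈ trapInterval m, δ ≤ |wordMap n v x - wordMap n w y| := by
  induction n with
  | zero => exact ⟨1, one_pos, fun v w h => absurd (Subsingleton.elim v w) h⟩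
  | succ n ih =>
    obtain ⟨δ₀, h₀, H₀⟩ := exists_le_abs_branch_sub m
    obtain ⟨δ₁, h₁, H₁⟩ := ih
    refine ⟨min δ₀ ((1 / ((m : ℝ) + 1)) ^ 2 * δ₁), by positivity, fun v w hvw x hx y hy => ?_⟩
    have hx' := wordMap_mem (Fin.tail v) hx
    have hy' := wordMap_mem (Fin.tail w) hy
    by_cases h : v 0 = w 0
    · have ht : Fin.tail v ≠ Fin.tail w := by
        intro ht
        apply hvw
        rw [← Fin.cons_self_tail v, ← Fin.cons_self_tail w, h, ht]
      refine (min_le_right _ _).trans ?_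
      have hk := trapInterval_pos (branch_mem_trapInterval (w 0) hx')
      have hl := trapInterval_pos (branch_mem_trapInterval (w 0) hy')
      simp only [wordMap]
      rw [h, branch_sub _ (trapInterval_pos hx').le (trapInterval_pos hy').le, sq]
      gcongr
      · exact (branch_mem_trapInterval (w 0) hx').1
      · exact (branch_mem_trapInterval (w 0) hy').1
      · exact H₁ _ _ ht _ hx _ hy
    · exact (min_le_left _ _).trans (H₀ _ _ h _ hx' _ hy')

end Branch

/-! ### Convergents and the self-similarity of the digit set -/

section Convergents

/-- The `n`-th convergent of `[0; a 0, a 1, …]`, computed from the front. -/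
noncomputable def contFractConv : ℕ → (ℕ → ℕ) → ℝ
  | 0, _ => 0
  | n + 1, a => ((a 0 : ℝ) + contFractConv n fun i => a (i + 1))⁻¹

lemma convs'Aux_ofStream (n : ℕ) (a : ℕ → ℕ) :
    GenContFract.convs'Aux
      (Stream'.Seq.ofStream (fun n => (⟨1, (a n : ℝ)⟩ : GenContFract.Pair ℝ))) n
      = contFractConv n a := by
  induction n generalizing a with
  | zero => rfl
  | succ n ih =>
    have h := ih fun i => a (i + 1)
    simp only [GenContFract.convs'Aux, contFractConv]
    rw [← h, ← one_div]
    rfl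

lemma digitContFract_convs (a : ℕ → ℕ) (ha : ∀ n, 1 ≤ a n) (n : ℕ) :
    (digitContFract a).convs n = contFractConv n a := by
  rw [GenContFract.convs_eq_convs', GenContFract.convs', ← convs'Aux_ofStream n a]
  · simp [digitContFract]
  · intro gp k _ h
    have : gp = ⟨1, (a k : ℝ)⟩ := by
      have h' : some (⟨1, (a k : ℝ)⟩ : GenContFract.Pair ℝ) = some gp := h
      exact (Option.some.inj h').symm
    subst this
    exact ⟨one_pos, Nat.cast_pos.2 (ha k)⟩

lemma contFractConv_mem_Icc (n : ℕ) (a : ℕ → ℕ) (ha : ∀ n, 1 ≤ a n) :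
    contFractConv n a ∈ Set.Icc (0 : ℝ) 1 := by
  induction n generalizing a with
  | zero => simp [contFractConv]
  | succ n ih =>
    have h := ih (fun i => a (i + 1)) fun i => ha _
    have h1 : (1 : ℝ) ≤ a 0 := by exact_mod_cast ha 0
    rw [contFractConv]
    exact ⟨inv_nonneg.2 (by linarith [h.1]), inv_le_one_of_one_le₀ (by linarith [h.1])⟩

lemma mem_cantorE_iff {m : ℕ} {x : ℝ} : x ∈ cantorE m ↔ ∃ a : ℕ → ℕ,
    (∀ n, 1 ≤ a n ∧ a n ≤ m) ∧ Tendsto (fun n => contFractConv n a) atTop (𝓝 x) := by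
  refine exists_congr fun a => and_congr_right fun ha => ?_
  simp_rw [digitContFract_convs a fun n => (ha n).1]

lemma cantorE_subset_Icc (m : ℕ) : cantorE m ⊆ Set.Icc 0 1 := by
  intro x hx
  obtain ⟨a, ha, h⟩ := mem_cantorE_iff.1 hx
  exact isClosed_Icc.mem_of_tendsto h
    (Eventually.of_forall fun n => contFractConv_mem_Icc n a fun i => (ha i).1)

lemma exists_branch_of_mem_cantorE {m : ℕ} {x : ℝ} (hx : x ∈ cantorE m) :
    ∃ k : Fin m, ∃ y ∈ cantorE m, x = branch k y := by
  obtain ⟨a, ha, h⟩ := mem_cantorE_iff.1 hx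
  have ha0 := ha 0
  set b : ℕ → ℕ := fun i => a (i + 1) with hb
  have hbI : ∀ n, contFractConv n b ∈ Set.Icc (0 : ℝ) 1 := fun n =>
    contFractConv_mem_Icc n b fun i => (ha _).1
  have h1 : (1 : ℝ) ≤ a 0 := by exact_mod_cast ha0.1
  have hs : Tendsto (fun n => ((a 0 : ℝ) + contFractConv n b)⁻¹) atTop (𝓝 x) :=
    h.comp (tendsto_add_atTop_nat 1)
  have hx0 : x ≠ 0 := by
    have : ((a 0 : ℝ) + 1)⁻¹ ≤ x := ge_of_tendsto hs (Eventually.of_forall fun n => by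
      apply inv_anti₀
      · linarith [(hbI n).1]
      · linarith [(hbI n).2])
    have : 0 < ((a 0 : ℝ) + 1)⁻¹ := by positivity
    linarith
  have ht : Tendsto (fun n => contFractConv n b) atTop (𝓝 (x⁻¹ - a 0)) := by
    have := (hs.inv₀ hx0).sub_const (a 0 : ℝ)
    simpa using this
  refine ⟨⟨a 0 - 1, by omega⟩, x⁻¹ - a 0, mem_cantorE_iff.2 ⟨b, fun n => ha _, ht⟩, ?_⟩
  have : ((a 0 - 1 : ℕ) : ℝ) = a 0 - 1 := by push_cast [ha0.1]; ring
  simp [branch, this]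

lemma cantorE_subset_trapInterval (m : ℕ) : cantorE m ⊆ trapInterval m := by
  have h1 : ∀ x ∈ cantorE m, 1 / ((m : ℝ) + 1) ≤ x := by
    intro x hx
    obtain ⟨k, y, hy, rfl⟩ := exists_branch_of_mem_cantorE hx
    exact le_branch k (cantorE_subset_Icc m hy).1 (cantorE_subset_Icc m hy).2
  intro x hx
  refine ⟨h1 x hx, ?_⟩
  obtain ⟨k, y, hy, rfl⟩ := exists_branch_of_mem_cantorE hx
  have hy1 := h1 y hy
  unfold branch
  have h : ((m : ℝ) + 2) / (m + 1) = 1 + 1 / ((m : ℝ) + 1) := by field_simp; ring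
  have hk : (0 : ℝ) ≤ k := by positivity
  rw [← inv_div ((m : ℝ) + 2), h]
  apply inv_anti₀ (by positivity)
  linarith

lemma exists_wordMap_of_mem_cantorE {m : ℕ} (n : ℕ) {x : ℝ} (hx : x ∈ cantorE m) :
    ∃ w : Fin n → Fin m, ∃ y ∈ cantorE m, x = wordMap n w y := by
  induction n generalizing x with
  | zero => exact ⟨Fin.elim0, x, hx, rfl⟩
  | succ n ih =>
    obtain ⟨k, y, hy, rfl⟩ := exists_branch_of_mem_cantorE hx
    obtain ⟨w, z, hz, rfl⟩ := ih hy
    exact ⟨Fin.cons k w, z, hz, by simp [wordMap]⟩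

/-- A subset of the trapping interval covered by its own images under the branches consists of
continued fractions with digits at most `m`. -/
lemma subset_cantorE {m : ℕ} {X : Set ℝ} (hX : X ⊆ trapInterval m)
    (h : ∀ x ∈ X, ∃ k : Fin m, ∃ y ∈ X, x = branch k y) : X ⊆ cantorE m := by
  have H : ∀ x : X, ∃ k : Fin m, ∃ y : X, (x : ℝ) = branch k y := fun x => by
    obtain ⟨k, y, hy, e⟩ := h x x.2
    exact ⟨k, ⟨y, hy⟩, e⟩
  choose k y hy using H
  -- Convergents may leave `trapInterval m`, so of the two factors in `branch_sub` only the one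
  -- equal to x is bounded by `trapRatio m`; the other is at most 1.
  have key : ∀ (n : ℕ) (x : X),
      |(x : ℝ) - contFractConv (n + 1) fun i => (k (y^[i] x) : ℕ) + 1| ≤ trapRatio m ^ n := by
    intro n
    have hpos : ∀ x : X, (0 : ℝ) < x := fun x => trapInterval_pos (hX x.2)
    have hle : ∀ x : X, (x : ℝ) ≤ trapRatio m := fun x => (hX x.2).2
    have e : ∀ (n : ℕ) (x : X), contFractConv (n + 1) (fun i => (k (y^[i] x) : ℕ) + 1) =
        branch (k x) (contFractConv n fun i => (k (y^[i] (y x)) : ℕ) + 1) := by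
      intro n x
      simp [contFractConv, branch]
    induction n with
    | zero =>
      intro x
      have h1 := contFractConv_mem_Icc 1 (fun i => (k (y^[i] x) : ℕ) + 1) (by simp)
      have h2 := hpos x
      have h3 := trapInterval_lt_one (hX x.2)
      simp only [zero_add, pow_zero]
      rw [abs_le]
      constructor <;> linarith [h1.1, h1.2]
    | succ n ih =>
      intro x
      have h1 := contFractConv_mem_Icc (n + 1) (fun i => (k (y^[i] (y x)) : ℕ) + 1) (by simp)
      rw [e, hy x, branch_sub _ (hpos _).le h1.1, ← hy x, pow_succ', mul_comm (x : ℝ), mul_assoc,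
        hy x, ← hy x]
      have h2 := branch_le_one (k x) h1.1
      have h3 := branch_pos (k x) h1.1
      have h4 := ih (y x)
      calc _ ≤ 1 * (trapRatio m * trapRatio m ^ n) := by
            have := (hpos x).le
            have := (trapRatio_pos m).le
            gcongr
            · exact hle x
        _ = _ := one_mul _
  intro x hx
  refine mem_cantorE_iff.2 ⟨fun i => (k (y^[i] ⟨x, hx⟩) : ℕ) + 1, fun n => ?_, ?_⟩
  · exact ⟨Nat.le_add_left _ _, (k (y^[n] ⟨x, hx⟩)).2⟩
  · rw [← tendsto_add_atTop_iff_nat 1, tendsto_iff_dist_tendsto_zero]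
    refine squeeze_zero (fun _ => dist_nonneg) (fun n => ?_)
      (tendsto_pow_atTop_nhds_zero_of_lt_one (trapRatio_pos m).le (trapRatio_lt_one m))
    rw [dist_comm, Real.dist_eq]
    exact key n ⟨x, hx⟩

end Convergents

/-! ### Transfer operator and the upper bound for the dimension -/

section Transfer

variable {m : ℕ}

/-- The transfer operator of the branches with exponent `s`. -/
noncomputable def transfer (m : ℕ) (s : ℝ) (f : ℝ → ℝ) (x : ℝ) : ℝ :=
  ∑ k : Fin m, branch k x ^ (2 * s) * f (branch k x)

/-- The iterates of the transfer operator, as sums over words. -/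
noncomputable def wordSum (m n : ℕ) (s : ℝ) (f : ℝ → ℝ) (x : ℝ) : ℝ :=
  ∑ w : Fin n → Fin m, wordScale n w x ^ (2 * s) * f (wordMap n w x)

lemma wordSum_zero (s : ℝ) (f : ℝ → ℝ) (x : ℝ) : wordSum m 0 s f x = f x := by
  simp [wordSum, wordScale, wordMap]

/-- The first letter is the outermost branch. Splitting it off leaves one application of the
operator at the point `wordMap n w x`, so `wordSum` is the n-th iterate. -/
lemma wordSum_succ (n : ℕ) (s : ℝ) (f : ℝ → ℝ) {x : ℝ} (hx : x ∈ trapInterval m) :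
    wordSum m (n + 1) s f x = wordSum m n s (transfer m s f) x := by
  unfold wordSum transfer
  rw [← (Fin.consEquiv fun _ : Fin (n + 1) => Fin m).sum_comp, Fintype.sum_prod_type,
    Finset.sum_comm]
  refine Finset.sum_congr rfl fun w _ => ?_
  rw [Finset.mul_sum]
  refine Finset.sum_congr rfl fun k _ => ?_
  have h1 : 0 < wordMap (n + 1) (Fin.cons k w : Fin (n + 1) → Fin m) x :=
    trapInterval_pos (wordMap_mem _ hx)
  have h2 := wordScale_pos w hx
  simp only [Fin.consEquiv, Equiv.coe_fn_mk, wordScale, wordMap, Fin.cons_zero, Fin.tail_cons] at h1 ⊢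
  rw [Real.mul_rpow h1.le h2.le]
  ring

lemma wordSum_mono (n : ℕ) (s : ℝ) {f g : ℝ → ℝ} (h : ∀ x ∈ trapInterval m, f x ≤ g x) {x : ℝ}
    (hx : x ∈ trapInterval m) : wordSum m n s f x ≤ wordSum m n s g x := by
  refine Finset.sum_le_sum fun w _ => ?_
  exact mul_le_mul_of_nonneg_left (h _ (wordMap_mem w hx))
    (Real.rpow_nonneg (wordScale_pos w hx).le _)

lemma wordSum_le {s : ℝ} {f : ℝ → ℝ} (h : ∀ x ∈ trapInterval m, transfer m s f x ≤ f x) (n : ℕ)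
    {x : ℝ} (hx : x ∈ trapInterval m) : wordSum m n s f x ≤ f x := by
  induction n with
  | zero => rw [wordSum_zero]
  | succ n ih => rw [wordSum_succ n s f hx]; exact (wordSum_mono n s h hx).trans ih

lemma le_wordSum {s : ℝ} {f : ℝ → ℝ} (h : ∀ x ∈ trapInterval m, f x ≤ transfer m s f x) (n : ℕ)
    {x : ℝ} (hx : x ∈ trapInterval m) : f x ≤ wordSum m n s f x := by
  induction n with
  | zero => rw [wordSum_zero]
  | succ n ih => rw [wordSum_succ n s f hx]; exact ih.trans (wordSum_mono n s h hx)

lemma trapInterval_nonempty (hm : 1 ≤ m) : (trapInterval m).Nonempty := by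
  have hm' : (1 : ℝ) ≤ m := by exact_mod_cast hm
  refine Set.nonempty_Icc.2 ?_
  rw [div_le_div_iff₀ (by positivity) (by positivity)]
  nlinarith

/-- A positive supersolution for the transfer operator bounds the dimension from above. -/
theorem dimH_cantorE_le {s : NNReal} {f : ℝ → ℝ} {lo hi : ℝ} (hlo : 0 < lo)
    (hf : ∀ x ∈ trapInterval m, lo ≤ f x ∧ f x ≤ hi)
    (h : ∀ x ∈ trapInterval m, transfer m s f x ≤ f x) : dimH (cantorE m) ≤ s := by
  rcases (cantorE m).eq_empty_or_nonempty with he | ⟨x₀, hx₀⟩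
  · simp [he]
  have hx₀ := cantorE_subset_trapInterval m hx₀
  have hs : (0 : ℝ) ≤ s := s.2
  -- The factor 4 is the distortion constant 2, once for each endpoint.
  have hdist : ∀ n (w : Fin n → Fin m), Metric.ediam (wordMap n w '' trapInterval m) ≤
      ENNReal.ofReal (4 * wordScale n w x₀ ^ 2) := by
    intro n w
    refine Metric.ediam_le ?_
    rintro _ ⟨x, hx, rfl⟩ _ ⟨y, hy, rfl⟩
    rw [edist_dist, Real.dist_eq, wordMap_sub w hx hy]
    apply ENNReal.ofReal_le_ofReal
    have h1 := wordScale_le_two_mul w hx hx₀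
    have h2 := wordScale_le_two_mul w hy hx₀
    have h3 := (wordScale_pos w hx).le
    have h4 := (wordScale_pos w hy).le
    have h5 : |x - y| ≤ 1 := by
      rw [abs_le]
      have := trapInterval_pos hx
      have := trapInterval_pos hy
      have := trapInterval_lt_one hx
      have := trapInterval_lt_one hy
      constructor <;> linarith
    have h6 := (wordScale_pos w hx₀).le
    calc _ ≤ (2 * wordScale n w x₀) * (2 * wordScale n w x₀) * 1 := by gcongr
      _ = _ := by ring
  -- As lo ≤ f ≤ hi, lo times the sum of the scales to the power 2s is at most L^n f(x₀) ≤ f(x₀) ≤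
  -- hi.
  have hsum : ∀ n, ∑ w : Fin n → Fin m, Metric.ediam (wordMap n w '' trapInterval m) ^ (s : ℝ) ≤
      ENNReal.ofReal ((4 : ℝ) ^ (s : ℝ) * (hi / lo)) := by
    intro n
    have hw := wordSum_le h n hx₀
    calc _ ≤ ∑ w : Fin n → Fin m, ENNReal.ofReal ((4 * wordScale n w x₀ ^ 2) ^ (s : ℝ)) := by
          refine Finset.sum_le_sum fun w _ => ?_
          rw [← ENNReal.ofReal_rpow_of_nonneg (by positivity) hs]
          exact ENNReal.rpow_le_rpow (hdist n w) hs
      _ = ENNReal.ofReal (∑ w : Fin n → Fin m, (4 * wordScale n w x₀ ^ 2) ^ (s : ℝ)) :=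
          (ENNReal.ofReal_sum_of_nonneg fun w _ => by positivity).symm
      _ ≤ _ := by
          apply ENNReal.ofReal_le_ofReal
          have e : ∀ w : Fin n → Fin m, (4 * wordScale n w x₀ ^ 2) ^ (s : ℝ) =
              (4 : ℝ) ^ (s : ℝ) * wordScale n w x₀ ^ (2 * (s : ℝ)) := by
            intro w
            rw [Real.mul_rpow (by norm_num) (by positivity), Real.rpow_mul (wordScale_pos w hx₀).le,
              Real.rpow_two]
          simp_rw [e]
          rw [← Finset.mul_sum]
          gcongr
          rw [le_div_iff₀ hlo, Finset.sum_mul]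
          refine le_trans ?_ (hw.trans (hf x₀ hx₀).2)
          refine Finset.sum_le_sum fun w _ => ?_
          exact mul_le_mul_of_nonneg_left (hf _ (wordMap_mem w hx₀)).1
            (Real.rpow_nonneg (wordScale_pos w hx₀).le _)
  apply dimH_le_of_hausdorffMeasure_ne_top
  refine ne_top_of_le_ne_top (b := ENNReal.ofReal ((4 : ℝ) ^ (s : ℝ) * (hi / lo)))
    ENNReal.ofReal_ne_top ?_
  refine (MeasureTheory.Measure.hausdorffMeasure_le_liminf_sum (s : ℝ) (cantorE m) (l := atTop)
    (fun n : ℕ => ENNReal.ofReal (4 * (trapRatio m ^ n) ^ 2)) ?_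
    (fun n (w : Fin n → Fin m) => wordMap n w '' trapInterval m) ?_ ?_).trans ?_
  · rw [← ENNReal.ofReal_zero]
    apply ENNReal.tendsto_ofReal
    have := ((tendsto_pow_atTop_nhds_zero_of_lt_one (trapRatio_pos m).le
      (trapRatio_lt_one m)).pow 2).const_mul 4
    simpa using this
  · refine Eventually.of_forall fun n w => (hdist n w).trans (ENNReal.ofReal_le_ofReal ?_)
    have := (wordScale_pos w hx₀).le
    have := wordScale_le w hx₀
    gcongr
  · refine Eventually.of_forall fun n x hx => ?_
    obtain ⟨w, y, hy, rfl⟩ := exists_wordMap_of_mem_cantorE n hx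
    exact Set.mem_iUnion.2 ⟨w, y, cantorE_subset_trapInterval m hy, rfl⟩
  · exact liminf_le_of_le (by isBoundedDefault) fun b hb => by
      obtain ⟨n, hn⟩ := hb.exists
      exact hn.trans (hsum n)

end Transfer

/-! ### Mass distribution for separated codings -/

section Moran

open MeasureTheory

/-- The product measure of the set of sequences with a given prefix. -/
lemma infinitePi_prefix {ι : Type*} [MeasurableSpace ι] [MeasurableSingletonClass ι]
    (μ : Measure ι) [IsProbabilityMeasure μ] (n : ℕ) (ω : ℕ → ι) :
    Measure.infinitePi (fun _ : ℕ => μ) {ω' | ∀ i < n, ω' i = ω i} =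
      ∏ i ∈ Finset.range n, μ {ω i} := by
  rw [← Measure.infinitePi_pi (μ := fun _ : ℕ => μ) (s := Finset.range n)
    (t := fun i => {ω i}) fun i _ => measurableSet_singleton _]
  congr 1
  ext ω'
  simp

/-- A separated coding of a set of reals by sequences whose cylinders of positive length have
diameter at least a product of ratios `r` with `∑ r ^ s ≥ 1` has image of dimension at least `s`. -/
theorem le_dimH_range_of_separated {ι : Type*} [Fintype ι] [MeasurableSpace ι] [MeasurableSingletonClass ι] {s : NNReal}
    (r : ι → ℝ) (hr0 : ∀ i, 0 < r i) (hr1 : ∀ i, r i < 1) (hs : 0 < s)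
    (hsum : 1 ≤ ∑ i, r i ^ (s : ℝ)) (π : (ℕ → ι) → ℝ) (hπ : Measurable π) {δ : ℝ} (hδ : 0 < δ)
    (hsep : ∀ (ω ω' : ℕ → ι) (n : ℕ), (∀ i < n, ω' i = ω i) → ω' n ≠ ω n →
      δ * ∏ i ∈ Finset.range n, r (ω i) ≤ |π ω - π ω'|) :
    (s : ENNReal) ≤ dimH (Set.range π) := by
  classical
  have hsR : (0 : ℝ) < s := hs
  set R : ℝ := ∑ i, r i ^ (s : ℝ) with hR
  have hR0 : 0 < R := by linarith
  have hι : Nonempty ι := by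
    by_contra h
    rw [not_nonempty_iff] at h
    simp at hR
    linarith
  set μ : Measure ι := ∑ i, ENNReal.ofReal (r i ^ (s : ℝ) / R) • Measure.dirac i with hμ
  -- Dividing by R ≥ 1 makes the weights a probability vector and only lowers them, so cylinder
  -- masses stay below the s-th power of the product of ratios.
  have hμi : ∀ i, μ {i} = ENNReal.ofReal (r i ^ (s : ℝ) / R) := by
    intro i
    rw [hμ]
    simp [Measure.finsetSum_apply, Set.indicator_apply]
  have hprob : IsProbabilityMeasure μ := by
    constructor
    rw [hμ]
    simp only [Measure.finsetSum_apply, Measure.smul_apply, measure_univ, smul_eq_mul, mul_one]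
    rw [← ENNReal.ofReal_sum_of_nonneg fun i _ => by have := hr0 i; positivity, ← Finset.sum_div,
      div_self hR0.ne', ENNReal.ofReal_one]
  have hμle : ∀ i, μ {i} ≤ ENNReal.ofReal (r i ^ (s : ℝ)) := by
    intro i
    rw [hμi]
    exact ENNReal.ofReal_le_ofReal (div_le_self (Real.rpow_nonneg (hr0 i).le _) hsum)
  set ν := Measure.infinitePi (fun _ : ℕ => μ) with hν
  have hcyl : ∀ (ω : ℕ → ι) (n : ℕ), ν {ω' | ∀ i < n, ω' i = ω i} ≤
      ENNReal.ofReal ((∏ i ∈ Finset.range n, r (ω i)) ^ (s : ℝ)) := by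
    intro ω n
    rw [hν, infinitePi_prefix, ← Real.finsetProd_rpow _ _ fun i _ => (hr0 _).le,
      ENNReal.ofReal_prod_of_nonneg fun i _ => Real.rpow_nonneg (hr0 _).le _]
    exact Finset.prod_le_prod' fun i _ => hμle _
  -- Absence of atoms handles sets whose preimage is a single sequence, where separation says
  -- nothing.
  have hpt : ∀ ω : ℕ → ι, ν {ω} = 0 := by
    intro ω
    obtain ⟨i₀, hi₀⟩ := Finite.exists_max r
    have hlim : Tendsto (fun n : ℕ => ENNReal.ofReal ((r i₀ ^ n) ^ (s : ℝ))) atTop (𝓝 0) := by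
      rw [← ENNReal.ofReal_zero, ← Real.zero_rpow hsR.ne']
      exact ENNReal.tendsto_ofReal
        ((tendsto_pow_atTop_nhds_zero_of_lt_one (hr0 _).le (hr1 _)).rpow_const (Or.inr hsR.le))
    refine le_antisymm (ge_of_tendsto' hlim fun n => ?_) zero_le
    refine (measure_mono ?_).trans ((hcyl ω n).trans (ENNReal.ofReal_le_ofReal ?_))
    · rintro ω' rfl i _
      rfl
    · refine Real.rpow_le_rpow (Finset.prod_nonneg fun i _ => (hr0 _).le) ?_ hsR.le
      calc _ ≤ ∏ i ∈ Finset.range n, r i₀ :=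
            Finset.prod_le_prod (fun i _ => (hr0 _).le) fun i _ => hi₀ _
        _ = _ := by simp
  have hmain : ∀ S : Set ℝ, Metric.ediam S ≤ 1 →
      (ENNReal.ofReal (δ ^ (s : ℝ)) • ν.map π) S ≤ Metric.ediam S ^ (s : ℝ) := by
    intro S hS
    rw [← Metric.ediam_closure S] at hS ⊢
    refine (measure_mono subset_closure).trans ?_
    set T := closure S
    rw [Measure.smul_apply, Measure.map_apply hπ isClosed_closure.measurableSet, smul_eq_mul]
    rcases (π ⁻¹' T).eq_empty_or_nonempty with he | ⟨ω, hω⟩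
    · rw [he, measure_empty, mul_zero]
      exact zero_le
    -- At the first index n where some sequence in the preimage departs from ω, the preimage lies in
    -- a cylinder of length n while two of its points are already separated at that scale.
    by_cases hex : ∃ n, ∃ ω' ∈ π ⁻¹' T, ω' n ≠ ω n
    · obtain ⟨ω', hω', hne⟩ := Nat.find_spec hex
      have hmin := fun i (hi : i < Nat.find hex) => Nat.find_min hex hi
      set n := Nat.find hex
      have hagree : ∀ ω'' ∈ π ⁻¹' T, ∀ i < n, ω'' i = ω i := by
        intro ω'' h'' i hi
        by_contra h
        exact hmin i hi ⟨ω'', h'', h⟩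
      have hd : ENNReal.ofReal (δ * ∏ i ∈ Finset.range n, r (ω i)) ≤ Metric.ediam T := by
        refine le_trans ?_ (Metric.edist_le_ediam_of_mem hω hω')
        rw [edist_dist, Real.dist_eq]
        exact ENNReal.ofReal_le_ofReal (hsep ω ω' n (hagree ω' hω') hne)
      have hp : 0 ≤ ∏ i ∈ Finset.range n, r (ω i) := Finset.prod_nonneg fun i _ => (hr0 _).le
      calc _ ≤ ENNReal.ofReal (δ ^ (s : ℝ)) *
              ENNReal.ofReal ((∏ i ∈ Finset.range n, r (ω i)) ^ (s : ℝ)) := by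
            gcongr
            exact (measure_mono hagree).trans (hcyl ω n)
        _ = ENNReal.ofReal (δ * ∏ i ∈ Finset.range n, r (ω i)) ^ (s : ℝ) := by
            rw [← ENNReal.ofReal_mul (by positivity), ← Real.mul_rpow hδ.le hp,
              ENNReal.ofReal_rpow_of_nonneg (by positivity) hsR.le]
        _ ≤ _ := ENNReal.rpow_le_rpow hd hsR.le
    · push Not at hex
      have : π ⁻¹' T ⊆ {ω} := fun ω' h' => funext fun n => hex n ω' h'
      rw [measure_mono_null this (hpt ω)]
      simp
  have hle := Measure.le_hausdorffMeasure (s : ℝ) _ 1 one_pos hmain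
  apply le_dimH_of_hausdorffMeasure_ne_zero
  have h1 := hle (Set.range π)
  intro h0
  rw [h0] at h1
  have h2 : (ν.map π) (Set.range π) = 1 := by
    refine le_antisymm ?_ ?_
    · have := Measure.isProbabilityMeasure_map (μ := ν) hπ.aemeasurable
      exact prob_le_one
    · refine le_trans ?_ (Measure.le_map_apply hπ.aemeasurable _)
      simp [Set.preimage_range]
  rw [Measure.smul_apply, h2, smul_eq_mul, mul_one] at h1
  have : 0 < δ ^ (s : ℝ) := by positivity
  exact absurd (le_antisymm h1 zero_le) (ENNReal.ofReal_pos.2 this).ne'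

end Moran

/-! ### Codings by blocks and the lower bound for the dimension -/

section LowerBound

/-- The coding map of an iterated function system contracting a bounded closed set of reals. -/
lemma exists_coding {ι : Type*} [Countable ι] [MeasurableSpace ι] [MeasurableSingletonClass ι]
    (ψ : ι → ℝ → ℝ) (hψ : ∀ i, Measurable (ψ i)) {I : Set ℝ} (hI : IsClosed I)
    (hne : I.Nonempty) (hdiam : ∀ x ∈ I, ∀ y ∈ I, |x - y| ≤ 1) (hmaps : ∀ i, ∀ x ∈ I, ψ i x ∈ I)
    {θ : ℝ} (h0 : 0 ≤ θ) (h1 : θ < 1)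
    (hcontr : ∀ i, ∀ x ∈ I, ∀ y ∈ I, |ψ i x - ψ i y| ≤ θ * |x - y|) :
    ∃ π : (ℕ → ι) → ℝ, Measurable π ∧ (∀ ω, π ω ∈ I) ∧
      ∀ ω, π ω = ψ (ω 0) (π fun i => ω (i + 1)) := by
  obtain ⟨x₀, hx₀⟩ := hne
  -- Finite compositions applied to x₀. Their limit is the coding map, and it inherits measurability
  -- from them.
  let c : ℕ → (ℕ → ι) → ℝ := fun n => n.rec (fun _ => x₀) fun _ g ω => ψ (ω 0) (g fun i => ω (i + 1))
  have c0 : ∀ ω, c 0 ω = x₀ := fun _ => rfl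
  have cs : ∀ n ω, c (n + 1) ω = ψ (ω 0) (c n fun i => ω (i + 1)) := fun _ _ => rfl
  have hcI : ∀ n ω, c n ω ∈ I := by
    intro n
    induction n with
    | zero => exact fun ω => hx₀
    | succ n ih => exact fun ω => hmaps _ _ (ih _)
  have hcm : ∀ n, Measurable (c n) := by
    intro n
    induction n with
    | zero => exact measurable_const
    | succ n ih =>
      have hp : Measurable fun p : ℝ × ι => ψ p.2 p.1 :=
        measurable_from_prod_countable_left fun i => hψ i
      exact hp.comp ((ih.comp (measurable_pi_lambda _ fun i => measurable_pi_apply (i + 1))).prodMk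
        (measurable_pi_apply 0))
  have hd : ∀ n ω, dist (c n ω) (c (n + 1) ω) ≤ 1 * θ ^ n := by
    intro n
    induction n with
    | zero =>
      intro ω
      simpa [Real.dist_eq] using hdiam _ (hcI 0 ω) _ (hcI 1 ω)
    | succ n ih =>
      intro ω
      rw [cs, cs (n + 1), Real.dist_eq]
      refine (hcontr (ω 0) _ (hcI n fun i => ω (i + 1)) _ (hcI (n + 1) fun i => ω (i + 1))).trans ?_
      rw [pow_succ', mul_left_comm, ← Real.dist_eq]
      exact mul_le_mul_of_nonneg_left (ih _) h0
  have hlim : ∀ ω, ∃ x, Tendsto (fun n => c n ω) atTop (𝓝 x) := fun ω =>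
    cauchySeq_tendsto_of_complete (cauchySeq_of_le_geometric θ 1 h1 fun n => hd n ω)
  choose π hπ using hlim
  have hπI : ∀ ω, π ω ∈ I := fun ω =>
    hI.mem_of_tendsto (hπ ω) (Eventually.of_forall fun n => hcI n ω)
  refine ⟨π, measurable_of_tendsto_metrizable hcm (tendsto_pi_nhds.2 hπ), hπI, fun ω => ?_⟩
  refine tendsto_nhds_unique ((hπ ω).comp (tendsto_add_atTop_nat 1)) ?_
  rw [tendsto_iff_dist_tendsto_zero]
  have ht := (tendsto_iff_dist_tendsto_zero.1 (hπ fun i => ω (i + 1))).const_mul θ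
  rw [mul_zero] at ht
  refine squeeze_zero (fun _ => dist_nonneg) (fun n => ?_) ht
  exact hcontr _ _ (hcI _ _) _ (hπI _)

variable {m : ℕ}

lemma abs_sub_le_one_of_mem_trapInterval {x y : ℝ} (hx : x ∈ trapInterval m)
    (hy : y ∈ trapInterval m) : |x - y| ≤ 1 := by
  have := trapInterval_pos hx
  have := trapInterval_pos hy
  have := trapInterval_lt_one hx
  have := trapInterval_lt_one hy
  rw [abs_le]
  constructor <;> linarith

/-- The image of a coding by blocks of `n` digits consists of continued fractions. -/
lemma range_subset_cantorE {n : ℕ} (hn : n ≠ 0) (π : (ℕ → Fin n → Fin m) → ℝ)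
    (hπI : ∀ ω, π ω ∈ trapInterval m)
    (hπ : ∀ ω, π ω = wordMap n (ω 0) (π fun i => ω (i + 1))) : Set.range π ⊆ cantorE m := by
  -- The coding unrolls n digits at once. Adjoining images under words of every length gives a set
  -- covered by single branches; at the empty word a whole block is unrolled, hence n ≠ 0.
  set X : Set ℝ := {x | ∃ j, ∃ v : Fin j → Fin m, ∃ ω, x = wordMap j v (π ω)} with hX
  have hsub : Set.range π ⊆ X := by
    rintro _ ⟨ω, rfl⟩
    exact ⟨0, Fin.elim0, ω, rfl⟩
  refine hsub.trans (subset_cantorE ?_ ?_)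
  · rintro _ ⟨j, v, ω, rfl⟩
    exact wordMap_mem v (hπI ω)
  · have key : ∀ j (v : Fin (j + 1) → Fin m) ω,
        ∃ k : Fin m, ∃ y ∈ X, wordMap (j + 1) v (π ω) = branch k y := fun j v ω =>
      ⟨v 0, wordMap j (Fin.tail v) (π ω), ⟨j, _, ω, rfl⟩, rfl⟩
    rintro _ ⟨j, v, ω, rfl⟩
    cases j with
    | succ j => exact key j v ω
    | zero =>
      obtain ⟨n, rfl⟩ := Nat.exists_eq_succ_of_ne_zero hn
      rw [wordMap, hπ ω]
      exact key n _ _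

/-- Passing from s to s' gains at least κ^(-n) with κ < 1, which for large n outweighs both lo / hi
and the halving. The halved scale is a lower bound for `wordScale` at every point of the interval.
-/
lemma exists_one_le_sum_wordScale {s s' : ℝ} (hs : s' < s) {f : ℝ → ℝ} {lo hi : ℝ} (hlo : 0 < lo)
    (hf : ∀ x ∈ trapInterval m, lo ≤ f x ∧ f x ≤ hi)
    (h : ∀ x ∈ trapInterval m, f x ≤ transfer m s f x) {x₀ : ℝ} (hx₀ : x₀ ∈ trapInterval m) :
    ∃ n ≠ 0, 1 ≤ ∑ w : Fin n → Fin m, ((wordScale n w x₀ / 2) ^ 2) ^ s' := by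
  have hhi : 0 < hi := hlo.trans_le ((hf x₀ hx₀).1.trans (hf x₀ hx₀).2)
  set κ : ℝ := trapRatio m ^ (2 * (s - s')) with hκ
  have hκ0 : 0 < κ := Real.rpow_pos_of_pos (trapRatio_pos m) _
  have hκ1 : κ < 1 := Real.rpow_lt_one (trapRatio_pos m).le (trapRatio_lt_one m) (by linarith)
  have hc : (0 : ℝ) < (1 / 2) ^ (2 * s') * (lo / hi) := by positivity
  obtain ⟨n, hn, hn0⟩ := (((tendsto_pow_atTop_nhds_zero_of_lt_one hκ0.le hκ1).eventually
    (gt_mem_nhds hc)).and (eventually_ne_atTop 0)).exists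
  refine ⟨n, hn0, ?_⟩
  have h1 : lo / hi ≤ ∑ w : Fin n → Fin m, wordScale n w x₀ ^ (2 * s) := by
    rw [div_le_iff₀ hhi, Finset.sum_mul]
    refine (hf x₀ hx₀).1.trans ((le_wordSum h n hx₀).trans (Finset.sum_le_sum fun w _ => ?_))
    exact mul_le_mul_of_nonneg_left (hf _ (wordMap_mem w hx₀)).2
      (Real.rpow_nonneg (wordScale_pos w hx₀).le _)
  have h2 : ∑ w : Fin n → Fin m, wordScale n w x₀ ^ (2 * s) ≤
      κ ^ n * ∑ w : Fin n → Fin m, wordScale n w x₀ ^ (2 * s') := by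
    rw [Finset.mul_sum]
    refine Finset.sum_le_sum fun w _ => ?_
    have hw := wordScale_pos w hx₀
    have e : 2 * s = 2 * (s - s') + 2 * s' := by ring
    rw [e, Real.rpow_add hw, hκ, ← Real.rpow_natCast, ← Real.rpow_mul (trapRatio_pos m).le,
      mul_comm _ (n : ℝ), Real.rpow_mul (trapRatio_pos m).le, Real.rpow_natCast]
    refine mul_le_mul_of_nonneg_right ?_ (Real.rpow_nonneg hw.le _)
    exact Real.rpow_le_rpow hw.le (wordScale_le w hx₀) (by linarith)
  have e : ∀ w : Fin n → Fin m, ((wordScale n w x₀ / 2) ^ 2) ^ s' =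
      (1 / 2) ^ (2 * s') * wordScale n w x₀ ^ (2 * s') := by
    intro w
    have hw := (wordScale_pos w hx₀).le
    rw [← Real.rpow_two, ← Real.rpow_mul (by positivity), div_eq_inv_mul, ← one_div,
      Real.mul_rpow (by norm_num) hw]
  simp_rw [e]
  rw [← Finset.mul_sum]
  set S := ∑ w : Fin n → Fin m, wordScale n w x₀ ^ (2 * s')
  have hκn : 0 < κ ^ n := by positivity
  have ha : (0 : ℝ) < (1 / 2) ^ (2 * s') := by positivity
  have h3 : κ ^ n ≤ (1 / 2) ^ (2 * s') * (κ ^ n * S) :=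
    hn.le.trans (mul_le_mul_of_nonneg_left (h1.trans h2) ha.le)
  rw [mul_left_comm] at h3
  exact le_of_mul_le_mul_left (by simpa using h3) hκn

/-- A positive subsolution for the transfer operator bounds the dimension from below. -/
theorem le_dimH_cantorE (hm : 1 ≤ m) {s : NNReal} {f : ℝ → ℝ} {lo hi : ℝ} (hlo : 0 < lo)
    (hf : ∀ x ∈ trapInterval m, lo ≤ f x ∧ f x ≤ hi)
    (h : ∀ x ∈ trapInterval m, f x ≤ transfer m s f x) : (s : ENNReal) ≤ dimH (cantorE m) := by
  refine ENNReal.le_of_forall_nnreal_lt fun s' hs' => ?_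
  rw [ENNReal.coe_lt_coe] at hs'
  rcases eq_or_ne s' 0 with rfl | hs0
  · simp
  have hne := trapInterval_nonempty hm
  obtain ⟨x₀, hx₀⟩ := hne
  obtain ⟨n, hn0, hn⟩ := exists_one_le_sum_wordScale (NNReal.coe_lt_coe.2 hs') hlo hf h hx₀
  have hscale : ∀ (w : Fin n → Fin m), ∀ x ∈ trapInterval m, wordScale n w x ≤ 1 := fun w x hx =>
    (wordScale_le w hx).trans (pow_le_one₀ (trapRatio_pos m).le (trapRatio_lt_one m).le)
  obtain ⟨π, hπm, hπI, hπ⟩ := exists_coding (wordMap n) (fun w : Fin n → Fin m => measurable_wordMap w)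
    (isClosed_Icc : IsClosed (trapInterval m)) ⟨x₀, hx₀⟩
    (fun x hx y hy => abs_sub_le_one_of_mem_trapInterval hx hy) (fun w x hx => wordMap_mem w hx)
    (trapRatio_pos m).le (trapRatio_lt_one m) (fun w x hx y hy => by
      rw [wordMap_sub w hx hy]
      refine mul_le_mul_of_nonneg_right ?_ (abs_nonneg _)
      calc wordScale n w x * wordScale n w y ≤ trapRatio m ^ n * 1 :=
            mul_le_mul (wordScale_le w hx) (hscale w y hy) (wordScale_pos w hy).le
              (pow_nonneg (trapRatio_pos m).le n)
        _ ≤ trapRatio m := by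
            rw [mul_one]
            exact pow_le_of_le_one (trapRatio_pos m).le (trapRatio_lt_one m).le hn0)
  obtain ⟨δ, hδ, hsep⟩ := exists_le_abs_wordMap_sub m n
  refine le_trans ?_ (dimH_mono (range_subset_cantorE hn0 π hπI hπ))
  refine le_dimH_range_of_separated (fun w => (wordScale n w x₀ / 2) ^ 2)
    (fun w => by have := wordScale_pos w hx₀; positivity) (fun w => ?_) (pos_iff_ne_zero.2 hs0) hn π
    hπm hδ ?_
  · have := wordScale_pos w hx₀
    have := hscale w x₀ hx₀
    nlinarith
  -- An agreeing first block multiplies distances by two scales, each at least half its value at x₀.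
  -- This accounts for the ratio (scale / 2)².
  · intro ω ω' N
    induction N generalizing ω ω' with
    | zero =>
      intro _ hne
      rw [hπ ω, hπ ω']
      simpa using hsep _ _ hne.symm _ (hπI _) _ (hπI _)
    | succ N ih =>
      intro hagree hne
      have h1 := ih (fun i => ω (i + 1)) (fun i => ω' (i + 1))
        (fun i hi => hagree (i + 1) (by omega)) hne
      rw [hπ ω, hπ ω', hagree 0 (by omega), wordMap_sub _ (hπI _) (hπI _), Finset.prod_range_succ']
      have h2 := wordScale_le_two_mul (ω 0) hx₀ (hπI fun i => ω (i + 1))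
      have h3 := wordScale_le_two_mul (ω 0) hx₀ (hπI fun i => ω' (i + 1))
      have h4 := wordScale_pos (ω 0) hx₀
      calc _ = (wordScale n (ω 0) x₀ / 2) * (wordScale n (ω 0) x₀ / 2) *
              (δ * ∏ i ∈ Finset.range N, (wordScale n (ω (i + 1)) x₀ / 2) ^ 2) := by ring
        _ ≤ _ := by
            have h5 : wordScale n (ω 0) x₀ / 2 ≤ wordScale n (ω 0) (π fun i => ω (i + 1)) := by
              linarith
            have h6 : wordScale n (ω 0) x₀ / 2 ≤ wordScale n (ω 0) (π fun i => ω' (i + 1)) := by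
              linarith
            refine mul_le_mul (mul_le_mul h5 h6 (by positivity) (by linarith)) h1 ?_ ?_
            · exact mul_nonneg hδ.le (Finset.prod_nonneg fun i _ => sq_nonneg _)
            · exact mul_nonneg (by linarith) (by linarith)

end LowerBound

/-! ### Binomial series with an explicit remainder -/

section BinomialSeries

/-- The coefficients of the binomial series of `(1 - z) ^ (-q)`. -/
noncomputable def risingCoeff (q : ℝ) (n : ℕ) : ℝ := (ascPochhammer ℝ n).eval q / n.factorial

lemma risingCoeff_succ (q : ℝ) (n : ℕ) :
    risingCoeff q (n + 1) = risingCoeff q n * ((q + n) / (n + 1)) := by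
  unfold risingCoeff
  rw [ascPochhammer_succ_eval, Nat.factorial_succ]
  push_cast
  field_simp

lemma risingCoeff_nonneg {q : ℝ} (hq : 0 ≤ q) (n : ℕ) : 0 ≤ risingCoeff q n := by
  induction n with
  | zero => simp [risingCoeff]
  | succ n ih => rw [risingCoeff_succ]; positivity

lemma hasSum_risingCoeff (q : ℝ) {z : ℝ} (hz : |z| < 1) :
    HasSum (fun n => risingCoeff q n * (-z) ^ n) ((1 + z) ^ (-q)) := by
  have h := (Real.one_div_one_sub_rpow_hasFPowerSeriesOnBall_zero q).hasSum (y := -z)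
    (by simpa [enorm_eq_nnnorm, ← NNReal.coe_lt_coe] using hz)
  simp only [zero_add, sub_neg_eq_add, one_div] at h
  rw [← Real.rpow_neg (by linarith [abs_lt.1 hz])] at h
  refine h.congr_fun fun n => ?_
  rw [FormalMultilinearSeries.ofScalars_apply_eq, smul_eq_mul]
  congr 1
  have e := Ring.factorial_nsmul_multichoose_eq_ascPochhammer q n
  rw [Polynomial.ascPochhammer_smeval_eq_eval] at e
  have e' : q + n - 1 - n + 1 = q := by ring
  rw [risingCoeff, Ring.choose, e', ← e, nsmul_eq_mul, mul_div_cancel_left₀]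
  exact_mod_cast n.factorial_ne_zero

/-- Truncation error of the binomial series in the disc of radius `1 / 4`. -/
lemma abs_one_add_rpow_sub_le {q z : ℝ} {N : ℕ} (hq : 0 ≤ q) (hz : |z| ≤ 1 / 4)
    (hN : q ≤ N + 2) :
    |(1 + z) ^ (-q) - ∑ n ∈ Finset.range N, risingCoeff q n * (-z) ^ n| ≤
      2 * (risingCoeff q N * |z| ^ N) := by
  have hs := hasSum_risingCoeff q (z := z) (by linarith)
  -- From index N on, q ≤ N + 2 makes each coefficient ratio at most 2, so with |z| ≤ 1/4 the terms
  -- at least halve.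
  have hterm : ∀ i, ‖risingCoeff q (i + N) * (-z) ^ (i + N)‖ ≤
      risingCoeff q N * |z| ^ N * (1 / 2) ^ i := by
    intro i
    rw [norm_mul, norm_pow, norm_neg, Real.norm_eq_abs, Real.norm_eq_abs,
      abs_of_nonneg (risingCoeff_nonneg hq _)]
    induction i with
    | zero => simp
    | succ i ih =>
      have e : i + 1 + N = i + N + 1 := by ring
      rw [e, risingCoeff_succ, pow_succ, pow_succ]
      have h2 : (q + (i + N : ℕ)) / ((i + N : ℕ) + 1) ≤ 2 := by
        rw [div_le_iff₀ (by positivity)]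
        push_cast
        linarith [(Nat.cast_nonneg i : (0 : ℝ) ≤ i)]
      have h0 : 0 ≤ (q + (i + N : ℕ)) / ((i + N : ℕ) + 1) := by positivity
      have h3 : (q + (i + N : ℕ)) / ((i + N : ℕ) + 1) * |z| ≤ 1 / 2 := by
        nlinarith [abs_nonneg z]
      have h4 : 0 ≤ risingCoeff q (i + N) * |z| ^ (i + N) :=
        mul_nonneg (risingCoeff_nonneg hq _) (by positivity)
      calc _ = risingCoeff q (i + N) * |z| ^ (i + N) *
            ((q + (i + N : ℕ)) / ((i + N : ℕ) + 1) * |z|) := by ring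
        _ ≤ risingCoeff q N * |z| ^ N * (1 / 2) ^ i * (1 / 2) :=
            mul_le_mul ih h3 (by positivity) (h4.trans ih)
        _ = _ := by ring
  have hb := tsum_of_norm_bounded
    (hasSum_geometric_two.mul_left (risingCoeff q N * |z| ^ N)) hterm
  rw [← hs.tsum_eq, ← hs.summable.sum_add_tsum_nat_add N, add_sub_cancel_left, ← Real.norm_eq_abs]
  linarith

end BinomialSeries

/-! ### Taylor expansion of the defect at 1/2 -/

section Expansion

/-- The reciprocal of the point `k + 3 / 2` about which the branches are expanded. -/
noncomputable def centerInv (k : Fin 6) : ℝ := 2 / (2 * (k : ℝ) + 3)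

/-- Weighted moments of the expansion points. -/
noncomputable def moment (W : Fin 6 → ℝ) (i : ℕ) : ℝ := ∑ k, W k * centerInv k ^ i

/-- The image of the polynomial with coefficients `c` under the branch of digit `k + 1`,
normalised at the center of expansion. -/
noncomputable def branchTerm (c : ℕ → ℝ) (M : ℕ) (q : ℝ) (k : Fin 6) (u : ℝ) : ℝ :=
  ∑ j ∈ Finset.range M, c j * (centerInv k ^ j * (1 + centerInv k * u) ^ (-(q + j)))

/-- The Taylor coefficients of `D f - ∑ W k * branchTerm k` at `1 / 2`, with `f` the polynomial with
coefficients `c`. -/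
noncomputable def defectCoeff (c : ℕ → ℝ) (M : ℕ) (D q : ℝ) (W : Fin 6 → ℝ) (n : ℕ) : ℝ :=
  ∑ j ∈ Finset.range M, c j * (D * (j.choose n * ((1 / 2) ^ j * 2 ^ n)) -
    (-1) ^ n * (risingCoeff (q + j) n * moment W (j + n)))

lemma centerInv_pos (k : Fin 6) : 0 < centerInv k := by unfold centerInv; positivity

lemma centerInv_mul_le (k : Fin 6) {u : ℝ} (hu : |u| ≤ 3 / 8) : |centerInv k * u| ≤ 1 / 4 := by
  have h : centerInv k ≤ 2 / 3 := by
    unfold centerInv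
    apply div_le_div_of_nonneg_left <;> first | positivity | linarith [(Nat.cast_nonneg k : (0:ℝ) ≤ (k : ℕ))]
  rw [abs_mul, abs_of_pos (centerInv_pos k)]
  nlinarith [abs_nonneg u]

lemma branch_eq (k : Fin 6) (u : ℝ) :
    branch k (1 / 2 + u) = centerInv k * (1 + centerInv k * u)⁻¹ := by
  unfold branch centerInv
  have h : 2 * (k : ℝ) + 3 ≠ 0 := by positivity
  rw [← div_eq_mul_inv, ← inv_div]
  field_simp
  ring

lemma branch_rpow_mul_sum (c : ℕ → ℝ) (M : ℕ) (q : ℝ) (k : Fin 6) {u : ℝ} (hu : |u| ≤ 3 / 8) :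
    branch k (1 / 2 + u) ^ q * ∑ j ∈ Finset.range M, c j * branch k (1 / 2 + u) ^ j =
      centerInv k ^ q * branchTerm c M q k u := by
  have h := abs_le.1 (centerInv_mul_le k hu)
  have h1 : 0 < 1 + centerInv k * u := by linarith
  have h0 := centerInv_pos k
  rw [branch_eq, branchTerm, Finset.mul_sum, Finset.mul_sum]
  refine Finset.sum_congr rfl fun j _ => ?_
  rw [Real.mul_rpow h0.le (by positivity), mul_pow, Real.rpow_neg h1.le, Real.rpow_add h1,
    Real.inv_rpow h1.le, Real.rpow_natCast, inv_pow, mul_inv]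
  ring

lemma abs_branchTerm_sub_le (c : ℕ → ℝ) {M N : ℕ} {q : ℝ} (hq : 0 ≤ q) (hN : q + M ≤ N + 2)
    (k : Fin 6) {u : ℝ} (hu : |u| ≤ 3 / 8) :
    |branchTerm c M q k u - ∑ n ∈ Finset.range N, (∑ j ∈ Finset.range M,
      c j * ((-1) ^ n * (risingCoeff (q + j) n * centerInv k ^ (j + n)))) * u ^ n| ≤
      ∑ j ∈ Finset.range M,
        |c j| * (2 * (risingCoeff (q + j) N * centerInv k ^ (j + N))) * (3 / 8) ^ N := by
  have h0 := centerInv_pos k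
  simp_rw [Finset.sum_mul]
  rw [Finset.sum_comm, branchTerm, ← Finset.sum_sub_distrib]
  refine (Finset.abs_sum_le_sum_abs _ _).trans (Finset.sum_le_sum fun j hj => ?_)
  have hjM : (j : ℝ) ≤ M := by exact_mod_cast (Finset.mem_range.1 hj).le
  have h := abs_one_add_rpow_sub_le (q := q + j) (z := centerInv k * u) (N := N) (by positivity)
    (centerInv_mul_le k hu) (by linarith)
  have e : c j * (centerInv k ^ j * (1 + centerInv k * u) ^ (-(q + j))) -
      ∑ n ∈ Finset.range N,
        c j * ((-1) ^ n * (risingCoeff (q + j) n * centerInv k ^ (j + n))) * u ^ n =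
      c j * centerInv k ^ j * ((1 + centerInv k * u) ^ (-(q + j)) -
        ∑ n ∈ Finset.range N, risingCoeff (q + j) n * (-(centerInv k * u)) ^ n) := by
    rw [mul_sub, Finset.mul_sum]
    congr 1
    · ring
    · refine Finset.sum_congr rfl fun n _ => ?_
      rw [neg_pow (centerInv k * u), mul_pow, pow_add]
      ring
  rw [e, abs_mul, abs_mul, abs_of_pos (pow_pos h0 j)]
  have hr := risingCoeff_nonneg (q := q + j) (by positivity) N
  calc _ ≤ |c j| * centerInv k ^ j * (2 * (risingCoeff (q + j) N * |centerInv k * u| ^ N)) := by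
        gcongr
    _ = |c j| * (2 * (risingCoeff (q + j) N * centerInv k ^ (j + N))) * |u| ^ N := by
        rw [abs_mul, abs_of_pos h0, mul_pow, pow_add]
        ring
    _ ≤ _ := by gcongr

lemma half_add_pow {j N : ℕ} (hj : j < N) (u : ℝ) :
    (1 / 2 + u) ^ j = ∑ n ∈ Finset.range N, j.choose n * ((1 / 2) ^ j * 2 ^ n) * u ^ n := by
  rw [add_comm, add_pow]
  have hsub : Finset.range (j + 1) ⊆ Finset.range N := Finset.range_subset_range.2 hj
  rw [← Finset.sum_subset hsub]
  · refine Finset.sum_congr rfl fun n hn => ?_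
    have hn' : n ≤ j := Nat.lt_succ_iff.1 (Finset.mem_range.1 hn)
    obtain ⟨i, rfl⟩ := Nat.exists_eq_add_of_le hn'
    rw [Nat.add_sub_cancel_left, pow_add (1 / 2 : ℝ) n i]
    have : (1 / 2 : ℝ) ^ n * 2 ^ n = 1 := by rw [← mul_pow]; norm_num
    linear_combination (-(u ^ n * (1 / 2) ^ i * ((n + i).choose n : ℝ))) * this
  · intro n _ hn
    rw [Nat.choose_eq_zero_of_lt (by simpa using hn)]
    simp

/-- With M ≤ N the polynomial part is expanded exactly, so the error consists only of the binomial
remainders of the branches, combined with nonnegative weights. -/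
lemma abs_defect_sub_le (c : ℕ → ℝ) {M N : ℕ} {D q : ℝ} (hq : 0 ≤ q) (hN : q + M ≤ N + 2)
    (hMN : M ≤ N) {W : Fin 6 → ℝ} (hW : ∀ k, 0 ≤ W k) {u : ℝ} (hu : |u| ≤ 3 / 8) :
    |D * (∑ j ∈ Finset.range M, c j * (1 / 2 + u) ^ j) - ∑ k, W k * branchTerm c M q k u -
      ∑ n ∈ Finset.range N, defectCoeff c M D q W n * u ^ n| ≤
    ∑ j ∈ Finset.range M,
      |c j| * (2 * (risingCoeff (q + j) N * moment W (j + N))) * (3 / 8) ^ N := by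
  have e1 : D * (∑ j ∈ Finset.range M, c j * (1 / 2 + u) ^ j) = ∑ n ∈ Finset.range N,
      (∑ j ∈ Finset.range M, c j * (D * (j.choose n * ((1 / 2) ^ j * 2 ^ n)))) * u ^ n := by
    simp_rw [Finset.sum_mul]
    rw [Finset.sum_comm, Finset.mul_sum]
    refine Finset.sum_congr rfl fun j hj => ?_
    rw [half_add_pow ((Finset.mem_range.1 hj).trans_le hMN), Finset.mul_sum, Finset.mul_sum]
    exact Finset.sum_congr rfl fun n _ => by ring
  have e2 : ∑ n ∈ Finset.range N, (∑ j ∈ Finset.range M, c j * ((-1) ^ n *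
      (risingCoeff (q + j) n * moment W (j + n)))) * u ^ n =
      ∑ k, W k * ∑ n ∈ Finset.range N, (∑ j ∈ Finset.range M,
      c j * ((-1) ^ n * (risingCoeff (q + j) n * centerInv k ^ (j + n)))) * u ^ n := by
    simp_rw [Finset.mul_sum]
    rw [Finset.sum_comm]
    refine Finset.sum_congr rfl fun n _ => ?_
    simp_rw [Finset.sum_mul, Finset.mul_sum]
    rw [Finset.sum_comm]
    refine Finset.sum_congr rfl fun j _ => ?_
    simp only [moment, Finset.mul_sum, Finset.sum_mul]
    exact Finset.sum_congr rfl fun k _ => by ring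
  have e3 : ∑ n ∈ Finset.range N, defectCoeff c M D q W n * u ^ n =
      D * (∑ j ∈ Finset.range M, c j * (1 / 2 + u) ^ j) -
        ∑ n ∈ Finset.range N, (∑ j ∈ Finset.range M, c j * ((-1) ^ n *
      (risingCoeff (q + j) n * moment W (j + n)))) * u ^ n := by
    rw [e1, ← Finset.sum_sub_distrib]
    refine Finset.sum_congr rfl fun n _ => ?_
    rw [← sub_mul, ← Finset.sum_sub_distrib, defectCoeff]
    congr 1
    exact Finset.sum_congr rfl fun j _ => by ring
  rw [e3, e2, sub_sub_sub_cancel_left, ← Finset.sum_sub_distrib]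
  refine (Finset.abs_sum_le_sum_abs _ _).trans ?_
  have e4 : ∑ j ∈ Finset.range M,
      |c j| * (2 * (risingCoeff (q + j) N * moment W (j + N))) * (3 / 8) ^ N =
      ∑ k, W k * ∑ j ∈ Finset.range M,
        |c j| * (2 * (risingCoeff (q + j) N * centerInv k ^ (j + N))) * (3 / 8) ^ N := by
    simp_rw [Finset.mul_sum]
    rw [Finset.sum_comm]
    refine Finset.sum_congr rfl fun j _ => ?_
    simp only [moment, Finset.mul_sum, Finset.sum_mul]
    exact Finset.sum_congr rfl fun k _ => by ring
  rw [e4]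
  refine Finset.sum_le_sum fun k _ => ?_
  rw [← mul_sub, abs_mul, abs_of_nonneg (hW k), abs_sub_comm]
  exact mul_le_mul_of_nonneg_left (abs_branchTerm_sub_le c hq hN k hu) (hW k)

end Expansion

/-! ### Integer certificate -/

section Certificate

/-- Integer coefficients of a polynomial approximating the eigenfunction of the transfer operator. -/
def certCoeffs : List ℤ :=
  [145651897867645769179, -129176791798628066484, 107401879441854966739, -90052623737269361082,
   76217878111076008653, -64879090223217106692, 55421182762661043532, -47454854356791473135,
   40704848770812929502, -34956923202337636017, 30028123097083456223, -25744247682727082780,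
   21923581910481358541, -18378341770822373204, 14948773781399934761, -11567397956434986274,
   8314842558138142355, -5407661059086834969, 3093518745684193230, -1509449608636079629,
   606044854090010896, -191130652584940982, 44212695621868334, -6650246020749556,
   486975494169834]

/-- The coefficients `certCoeffs`, extended by zero. -/
def certCoeff (j : ℕ) : ℤ := certCoeffs.getD j 0

/-- Lower bounds for `10 ^ 20 * (k + 3 / 2) ^ (-2 s)`, with `2 s = 1.7352383464801`. -/
def lowerWeight (k : ℕ) : ℕ :=
  ([49481139770816294469, 20392911633356664078, 11373974921723430139,
   7353948729185412406, 5191516885307540093, 3885094359186378177] : List ℕ).getD k 0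

/-- Upper bounds for `10 ^ 20 * (k + 3 / 2) ^ (-2 s)`, with `2 s = 1.7352383464805`. -/
def upperWeight (k : ℕ) : ℕ :=
  ([49481139770808271320, 20392911633349191745, 11373974921717732583,
   7353948729180990044, 5191516885304002003, 3885094359183471327] : List ℕ).getD k 0

/-- `risingCoeff (A / B + j) n` times `B ^ n * n!`. -/
def scaledRising (A B j : ℕ) : ℕ → ℕ
  | 0 => 1
  | n + 1 => scaledRising A B j n * (A + (j + n) * B)

/-- `moment W i` times `45045 ^ i`. -/
def scaledMoment (W : ℕ → ℕ) (i : ℕ) : ℕ :=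
  W 0 * 30030 ^ i + W 1 * 18018 ^ i + W 2 * 12870 ^ i +
    W 3 * 10010 ^ i + W 4 * 8190 ^ i + W 5 * 6930 ^ i

/-- `defectCoeff` for `certCoeff`, `A / B`, `W`, cleared of denominators. -/
def scaledDefect (A B : ℕ) (W : ℕ → ℕ) (n : ℕ) : ℤ :=
  ∑ j ∈ Finset.range 25, certCoeff j *
    (((10 ^ 20 * j.choose n * 2 ^ (n + 24 - j) *
        (B ^ n * n.factorial * 45045 ^ (24 + n)) : ℕ) : ℤ) -
      (-1) ^ n * ((2 ^ 24 * scaledRising A B j n * scaledMoment W (j + n) * 45045 ^ (24 - j) : ℕ) : ℤ))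

/-- The bound for the truncation error, cleared of denominators. -/
def scaledTail (A B : ℕ) (W : ℕ → ℕ) : ℕ :=
  ∑ j ∈ Finset.range 25, (certCoeff j).natAbs *
      (2 ^ 24 * scaledRising A B j 45 * scaledMoment W (j + 45) * 45045 ^ (24 - j))

/-- The share, in percent of the constant term, allotted to the `n`-th Taylor coefficient. -/
def slot (n : ℕ) : ℕ := if n < 5 then 10 else 1

/-- The constant Taylor coefficient of the defect dominates all the others and the tail. -/
def DefectDominated (A B : ℕ) (W : ℕ → ℕ) : Prop :=
  (∀ n < 45, n ≠ 0 → 100 * (scaledDefect A B W n).natAbs * 3 ^ n ≤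
    slot n * (scaledDefect A B W 0).natAbs * 8 ^ n * (B ^ n * n.factorial * 45045 ^ n)) ∧
  20 * scaledTail A B W * 3 ^ 45 ≤
    (scaledDefect A B W 0).natAbs * 8 ^ 45 * (B ^ 45 * Nat.factorial 45 * 45045 ^ 45)

instance decidableDefectDominated (A B : ℕ) (W : ℕ → ℕ) : Decidable (DefectDominated A B W) := by
  unfold DefectDominated; infer_instance

-- The numerical core of the upper bound, at twice the upper endpoint 0.86761917324015 + 10⁻¹³.
-- `defect_lower` is its counterpart with the opposite sign at the lower endpoint.
set_option maxRecDepth 10000 in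
set_option exponentiation.threshold 5000 in
lemma defect_upper : 0 < scaledDefect 17352383464805 (10 ^ 13) upperWeight 0 ∧
    DefectDominated 17352383464805 (10 ^ 13) upperWeight := by decide +kernel

set_option maxRecDepth 10000 in
set_option exponentiation.threshold 5000 in
lemma defect_lower : scaledDefect 17352383464801 (10 ^ 13) lowerWeight 0 < 0 ∧
    DefectDominated 17352383464801 (10 ^ 13) lowerWeight := by decide +kernel

lemma scaledRising_cast (A : ℕ) {B : ℕ} (hB : 0 < B) (j n : ℕ) :
    (scaledRising A B j n : ℝ) = (B ^ n * n.factorial) * risingCoeff (A / B + j) n := by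
  induction n with
  | zero => simp [scaledRising, risingCoeff]
  | succ n ih =>
    rw [scaledRising, risingCoeff_succ, Nat.factorial_succ]
    push_cast
    rw [ih]
    field_simp
    ring

/-- 45045 is the least common multiple of 3, 5, 7, 9, 11, 13, so every 2 · 45045 / (2k + 3) is an
integer. -/
lemma scaledMoment_cast (W : ℕ → ℕ) (i : ℕ) :
    (scaledMoment W i : ℝ) = 45045 ^ i * moment (fun k => (W k : ℝ)) i := by
  have h : ∀ c d : ℝ, c = 45045 * d → c ^ i = 45045 ^ i * d ^ i := fun c d e => by
    rw [e, mul_pow]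
  unfold scaledMoment moment centerInv
  push_cast
  rw [Fin.sum_univ_six, h 30030 (2 / (2 * ((0 : Fin 6) : ℝ) + 3)) (by norm_num),
    h 18018 (2 / (2 * ((1 : Fin 6) : ℝ) + 3)) (by norm_num),
    h 12870 (2 / (2 * ((2 : Fin 6) : ℝ) + 3)) (by norm_num),
    h 10010 (2 / (2 * ((3 : Fin 6) : ℝ) + 3)) (by norm_num),
    h 8190 (2 / (2 * ((4 : Fin 6) : ℝ) + 3)) (by norm_num),
    h 6930 (2 / (2 * ((5 : Fin 6) : ℝ) + 3)) (by norm_num)]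
  simp
  ring

end Certificate

/-! ### From integer inequalities to the sign of the defect -/

section Soundness

/-- The polynomial with coefficients `certCoeff`. -/
noncomputable def certPoly (x : ℝ) : ℝ := ∑ j ∈ Finset.range 25, (certCoeff j : ℝ) * x ^ j

/-- The Taylor coefficients of the defect of the certificate. -/
noncomputable def certDefect (A B : ℕ) (W : ℕ → ℕ) (n : ℕ) : ℝ :=
  defectCoeff (fun j => (certCoeff j : ℝ)) 25 (10 ^ 20) (A / B) (fun k => (W k : ℝ)) n

/-- The common denominator of the Taylor coefficients of order `n`. -/
noncomputable def certDenom (B n : ℕ) : ℝ := 2 ^ 24 * (B ^ n * n.factorial * 45045 ^ (24 + n))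

lemma certDenom_pos {B : ℕ} (hB : 0 < B) (n : ℕ) : 0 < certDenom B n := by
  unfold certDenom; positivity

lemma certDenom_eq (B n : ℕ) :
    certDenom B n = certDenom B 0 * (B ^ n * n.factorial * 45045 ^ n) := by
  unfold certDenom
  rw [pow_add]
  simp
  ring

lemma scaledDefect_cast (A : ℕ) {B : ℕ} (hB : 0 < B) (W : ℕ → ℕ) (n : ℕ) :
    (scaledDefect A B W n : ℝ) = certDenom B n * certDefect A B W n := by
  unfold scaledDefect certDefect defectCoeff certDenom
  rw [Int.cast_sum, Finset.mul_sum]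
  refine Finset.sum_congr rfl fun j hj => ?_
  obtain ⟨i, hi⟩ := Nat.exists_eq_add_of_le (Nat.lt_succ_iff.1 (Finset.mem_range.1 hj))
  have e1 : n + 24 - j = n + i := by omega
  have e2 : 24 - j = i := by omega
  have e3 : (2 : ℝ) ^ 24 * (1 / 2) ^ j = 2 ^ i := by
    rw [hi, pow_add, mul_right_comm, ← mul_pow]
    norm_num
  have e4 : (45045 : ℝ) ^ (24 + n) = 45045 ^ (j + n) * 45045 ^ i := by
    rw [← pow_add]
    congr 1
    omega
  rw [e1, e2]
  push_cast
  rw [scaledRising_cast A hB, scaledMoment_cast, e4, pow_add 2 n i, ← e3]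
  ring

lemma scaledTail_cast (A : ℕ) {B : ℕ} (hB : 0 < B) (W : ℕ → ℕ) :
    (scaledTail A B W : ℝ) = certDenom B 45 * ∑ j ∈ Finset.range 25, |(certCoeff j : ℝ)| *
      (risingCoeff (A / B + j) 45 * moment (fun k => (W k : ℝ)) (j + 45)) := by
  unfold scaledTail certDenom
  rw [Nat.cast_sum, Finset.mul_sum]
  refine Finset.sum_congr rfl fun j hj => ?_
  obtain ⟨i, hi⟩ := Nat.exists_eq_add_of_le (Nat.lt_succ_iff.1 (Finset.mem_range.1 hj))
  have e2 : 24 - j = i := by omega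
  have e4 : (45045 : ℝ) ^ (24 + 45) = 45045 ^ (j + 45) * 45045 ^ i := by
    rw [← pow_add]
    congr 1
    omega
  rw [e2, e4]
  push_cast
  rw [scaledRising_cast A hB, scaledMoment_cast, Nat.cast_natAbs, Int.cast_abs]
  ring

lemma DefectDominated.abs_coeff_le {A B : ℕ} (hB : 0 < B) {W : ℕ → ℕ}
    (h : DefectDominated A B W) {n : ℕ} (hn : n < 45) (hn0 : n ≠ 0) :
    |certDefect A B W n| * (3 / 8) ^ n ≤ slot n / 100 * |certDefect A B W 0| := by
  have h1 : (100 * (scaledDefect A B W n).natAbs * 3 ^ n : ℝ) ≤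
      slot n * (scaledDefect A B W 0).natAbs * 8 ^ n * (B ^ n * n.factorial * 45045 ^ n) := by
    exact_mod_cast h.1 n hn hn0
  have hd := certDenom_pos hB 0
  have hd' : (0 : ℝ) < B ^ n * n.factorial * 45045 ^ n := by positivity
  rw [Nat.cast_natAbs, Nat.cast_natAbs, Int.cast_abs, Int.cast_abs, scaledDefect_cast A hB,
    scaledDefect_cast A hB, abs_mul, abs_mul, abs_of_pos (certDenom_pos hB n), abs_of_pos hd,
    certDenom_eq] at h1
  rw [div_pow, mul_div_assoc', div_le_iff₀ (by positivity)]
  refine le_of_mul_le_mul_left ?_ (mul_pos hd hd')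
  nlinarith

lemma DefectDominated.tail_le {A B : ℕ} (hB : 0 < B) {W : ℕ → ℕ} (h : DefectDominated A B W) :
    ∑ j ∈ Finset.range 25, |(certCoeff j : ℝ)| * (2 * (risingCoeff (A / B + j) 45 *
      moment (fun k => (W k : ℝ)) (j + 45))) * (3 / 8) ^ 45 ≤ 1 / 10 * |certDefect A B W 0| := by
  have h1 : (20 * scaledTail A B W * 3 ^ 45 : ℝ) ≤ (scaledDefect A B W 0).natAbs * 8 ^ 45 *
      (B ^ 45 * Nat.factorial 45 * 45045 ^ 45) := by
    exact_mod_cast h.2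
  have hd := certDenom_pos hB 0
  have hd' : (0 : ℝ) < B ^ 45 * Nat.factorial 45 * 45045 ^ 45 := by positivity
  rw [Nat.cast_natAbs, Int.cast_abs, scaledDefect_cast A hB, scaledTail_cast A hB, abs_mul,
    abs_of_pos hd, certDenom_eq] at h1
  have e : ∑ j ∈ Finset.range 25, |(certCoeff j : ℝ)| * (2 * (risingCoeff (A / B + j) 45 *
      moment (fun k => (W k : ℝ)) (j + 45))) * (3 / 8) ^ 45 =
      2 * (∑ j ∈ Finset.range 25, |(certCoeff j : ℝ)| * (risingCoeff (A / B + j) 45 *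
      moment (fun k => (W k : ℝ)) (j + 45))) * (3 / 8) ^ 45 := by
    rw [Finset.mul_sum, Finset.sum_mul]
    exact Finset.sum_congr rfl fun j _ => by ring
  rw [e]
  generalize (∑ j ∈ Finset.range 25, |(certCoeff j : ℝ)| * (risingCoeff (A / B + j) 45 *
      moment (fun k => (W k : ℝ)) (j + 45))) = T at h1 ⊢
  generalize (B ^ 45 * Nat.factorial 45 * 45045 ^ 45 : ℝ) = d at h1 hd'
  rw [div_pow, mul_div_assoc', div_le_iff₀ (by positivity)]
  refine le_of_mul_le_mul_left ?_ (mul_pos hd hd')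
  nlinarith

/-- The defect differs from its constant coefficient by no more than that coefficient's size, hence
has its sign. The bound 22 on A / B is what the remainder estimate needs: 22 + 25 = 45 + 2. -/
lemma DefectDominated.abs_sub_le {A B : ℕ} (hB : 0 < B) (hA : A ≤ 22 * B) {W : ℕ → ℕ}
    (h : DefectDominated A B W) {u : ℝ} (hu : |u| ≤ 3 / 8) :
    |10 ^ 20 * certPoly (1 / 2 + u) -
      ∑ k : Fin 6, (W k : ℝ) * branchTerm (fun j => (certCoeff j : ℝ)) 25 (A / B) k u -
      certDefect A B W 0| ≤ |certDefect A B W 0| := by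
  have hq : (A : ℝ) / B ≤ 22 := by
    rw [div_le_iff₀ (by positivity)]
    exact_mod_cast hA
  have h1 := (abs_defect_sub_le (fun j => (certCoeff j : ℝ)) (M := 25) (N := 45) (D := 10 ^ 20)
    (q := A / B) (by positivity) (by push_cast; linarith) (by norm_num)
    (W := fun k => (W k : ℝ)) (fun k => by positivity) hu).trans (h.tail_le hB)
  have h2 : |∑ n ∈ Finset.range 44, certDefect A B W (n + 1) * u ^ (n + 1)| ≤
      8 / 10 * |certDefect A B W 0| := by
    calc _ ≤ ∑ n ∈ Finset.range 44, (slot (n + 1) : ℝ) / 100 * |certDefect A B W 0| := by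
          refine (Finset.abs_sum_le_sum_abs _ _).trans (Finset.sum_le_sum fun n hn => ?_)
          have hn' := Finset.mem_range.1 hn
          refine le_trans ?_ (h.abs_coeff_le hB (n := n + 1) (by omega) (by omega))
          rw [abs_mul, abs_pow]
          gcongr
      _ = _ := by
          rw [← Finset.sum_mul, ← Finset.sum_div, ← Nat.cast_sum]
          -- Four slots of 10 percent and forty of 1 percent; the tail takes another 10.
          have : ∑ n ∈ Finset.range 44, slot (n + 1) = 80 := by decide
          rw [this]
          norm_num
  rw [Finset.sum_range_succ' _ 44] at h1
  simp only [pow_zero, mul_one] at h1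
  change |10 ^ 20 * certPoly (1 / 2 + u) - _ -
    (∑ n ∈ Finset.range 44, certDefect A B W (n + 1) * u ^ (n + 1) + certDefect A B W 0)| ≤ _ at h1
  have := abs_nonneg (certDefect A B W 0)
  rw [abs_le] at h1 h2 ⊢
  constructor <;> linarith [h1.1, h1.2, h2.1, h2.2]

lemma sum_branchTerm_le {A B : ℕ} (hB : 0 < B) (hA : A ≤ 22 * B) {W : ℕ → ℕ}
    (h0 : 0 < scaledDefect A B W 0) (h : DefectDominated A B W) {u : ℝ} (hu : |u| ≤ 3 / 8) :
    ∑ k : Fin 6, (W k : ℝ) * branchTerm (fun j => (certCoeff j : ℝ)) 25 (A / B) k u ≤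
      10 ^ 20 * certPoly (1 / 2 + u) := by
  have h1 : 0 < certDefect A B W 0 := by
    have : (0 : ℝ) < scaledDefect A B W 0 := by exact_mod_cast h0
    rw [scaledDefect_cast A hB] at this
    exact pos_of_mul_pos_right this (certDenom_pos hB 0).le
  have h2 := h.abs_sub_le hB hA hu
  rw [abs_of_pos h1, abs_le] at h2
  linarith [h2.1]

lemma le_sum_branchTerm {A B : ℕ} (hB : 0 < B) (hA : A ≤ 22 * B) {W : ℕ → ℕ}
    (h0 : scaledDefect A B W 0 < 0) (h : DefectDominated A B W) {u : ℝ} (hu : |u| ≤ 3 / 8) :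
    10 ^ 20 * certPoly (1 / 2 + u) ≤
      ∑ k : Fin 6, (W k : ℝ) * branchTerm (fun j => (certCoeff j : ℝ)) 25 (A / B) k u := by
  have h1 : certDefect A B W 0 < 0 := by
    have : (scaledDefect A B W 0 : ℝ) < 0 := by exact_mod_cast h0
    rw [scaledDefect_cast A hB] at this
    exact neg_of_mul_neg_right this (certDenom_pos hB 0).le
  have h2 := h.abs_sub_le hB hA hu
  rw [abs_of_neg h1, abs_le] at h2
  linarith [h2.2]

/-- Grouped in pairs, c_{2i} x^{2i} + c_{2i+1} x^{2i+1} is nonnegative on [0, 1], because c_{2i} and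
c_{2i} + c_{2i+1} are. The first pair is at least c₀ + c₁ > 0. -/
lemma certPoly_bounds : ∃ lo hi : ℝ, 0 < lo ∧
    ∀ x ∈ Set.Icc (0 : ℝ) 1, lo ≤ certPoly x ∧ certPoly x ≤ hi := by
  have hpair : ∀ i < 12, 0 ≤ certCoeff (2 * i) ∧ 0 ≤ certCoeff (2 * i) + certCoeff (2 * i + 1) := by
    decide
  have hlast : 0 ≤ certCoeff 24 := by decide
  have h0 : 0 < certCoeff 0 + certCoeff 1 := by decide
  have h1' : certCoeff 1 ≤ 0 := by decide
  refine ⟨certCoeff 0 + certCoeff 1, ∑ j ∈ Finset.range 25, |(certCoeff j : ℝ)|,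
    by exact_mod_cast h0, fun x hx => ⟨?_, ?_⟩⟩
  · have hsum : ∀ N, N < 12 → (certCoeff 0 + certCoeff 1 : ℝ) ≤
        ∑ j ∈ Finset.range (2 * N + 2), (certCoeff j : ℝ) * x ^ j := by
      intro N hN
      induction N with
      | zero =>
        have : (certCoeff 1 : ℝ) ≤ 0 := by exact_mod_cast h1'
        simp only [mul_zero, zero_add, Finset.sum_range_succ, Finset.sum_range_zero, pow_zero,
          pow_one, mul_one]
        nlinarith [hx.2]
      | succ N ih =>
        have e : 2 * (N + 1) + 2 = 2 * (N + 1) + 1 + 1 := by ring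
        have ih' := ih (by omega)
        obtain ⟨p1, p2⟩ := hpair (N + 1) hN
        have p1' : (0 : ℝ) ≤ certCoeff (2 * (N + 1)) := by exact_mod_cast p1
        have p2' : (0 : ℝ) ≤ certCoeff (2 * (N + 1)) + certCoeff (2 * (N + 1) + 1) := by
          exact_mod_cast p2
        rw [e, Finset.sum_range_succ, Finset.sum_range_succ, pow_succ]
        have hp : 0 ≤ x ^ (2 * (N + 1)) := pow_nonneg hx.1 _
        have : 0 ≤ x ^ (2 * (N + 1)) * (certCoeff (2 * (N + 1)) +
            certCoeff (2 * (N + 1) + 1) * x) := by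
          refine mul_nonneg hp ?_
          nlinarith [hx.1, hx.2]
        have e' : 2 * (N + 1) = 2 * N + 2 := by ring
        rw [← e'] at ih'
        linarith
    have := hsum 11 (by norm_num)
    rw [certPoly, Finset.sum_range_succ]
    have h24 : (0 : ℝ) ≤ certCoeff 24 * x ^ 24 :=
      mul_nonneg (by exact_mod_cast hlast) (pow_nonneg hx.1 _)
    linarith
  · refine Finset.sum_le_sum fun j _ => ?_
    calc _ ≤ |(certCoeff j : ℝ)| * 1 :=
          mul_le_mul (le_abs_self _) (pow_le_one₀ hx.1 hx.2) (pow_nonneg hx.1 _) (abs_nonneg _)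
      _ = _ := mul_one _

end Soundness

/-! ### Rational bounds for the weights -/

section Weights

lemma log_bounds {z lo hi : ℝ} (hz0 : 0 ≤ z) (hz1 : z < 1) (n : ℕ)
    (h1 : lo ≤ 2 * ∑ i ∈ Finset.range n, z ^ (2 * i + 1) / (2 * i + 1))
    (h2 : 2 * (∑ i ∈ Finset.range n, z ^ (2 * i + 1) / (2 * i + 1) +
      z ^ (2 * n + 1) / (1 - z ^ 2)) ≤ hi) :
    lo ≤ Real.log ((1 + z) / (1 - z)) ∧ Real.log ((1 + z) / (1 - z)) ≤ hi := by
  have h3 := Real.sum_range_le_log_div hz0 hz1 n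
  have h4 := Real.log_div_le_sum_range_add hz0 hz1 n
  constructor <;> linarith

/-- The Taylor polynomial of degree `21` of the exponential. -/
noncomputable def expTaylor (t : ℝ) : ℝ := ∑ i ∈ Finset.range 22, t ^ i / i.factorial

lemma abs_exp_sub_expTaylor_le {t : ℝ} (ht : |t| ≤ 1) : |Real.exp t - expTaylor t| ≤ 1 / 10 ^ 20 := by
  refine (Real.exp_bound ht (n := 22) (by norm_num)).trans ?_
  calc _ ≤ 1 * ((22 : ℕ).succ / ((22 : ℕ).factorial * (22 : ℕ)) : ℝ) := by
        gcongr
        exact pow_le_one₀ (abs_nonneg t) ht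
    _ ≤ _ := by norm_num [Nat.factorial]

lemma inv_rpow_eq_exp {K : ℝ} (hK : 0 < K) (q : ℝ) : K⁻¹ ^ q = Real.exp (-(q * Real.log K)) := by
  rw [Real.rpow_def_of_pos (inv_pos.2 hK), Real.log_inv]
  ring_nf

/-- The exponents needed reach about -3.25. A quarter of each lies in [-1, 1], where the Taylor
bound applies, and the fourth power restores it. -/
lemma inv_rpow_le {K q l t w : ℝ} (hK : 0 < K) (hq : 0 ≤ q) (hl : l ≤ Real.log K)
    (ht : -(q * l) ≤ 4 * t) (ht1 : |t| ≤ 1) (hw : (expTaylor t + 1 / 10 ^ 20) ^ 4 ≤ w) :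
    K⁻¹ ^ q ≤ w := by
  have h := (abs_le.1 (abs_exp_sub_expTaylor_le ht1)).2
  calc K⁻¹ ^ q = Real.exp (-(q * Real.log K)) := inv_rpow_eq_exp hK q
    _ ≤ Real.exp ((4 : ℕ) * t) := by
        apply Real.exp_le_exp.2
        push_cast
        nlinarith
    _ = Real.exp t ^ 4 := Real.exp_nat_mul t 4
    _ ≤ (expTaylor t + 1 / 10 ^ 20) ^ 4 := by
        have := Real.exp_pos t
        gcongr
        linarith
    _ ≤ w := hw

lemma le_inv_rpow {K q l t w : ℝ} (hK : 0 < K) (hq : 0 ≤ q) (hl : Real.log K ≤ l)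
    (ht : 4 * t ≤ -(q * l)) (ht1 : |t| ≤ 1) (h0 : 0 ≤ expTaylor t - 1 / 10 ^ 20)
    (hw : w ≤ (expTaylor t - 1 / 10 ^ 20) ^ 4) : w ≤ K⁻¹ ^ q := by
  have h := (abs_le.1 (abs_exp_sub_expTaylor_le ht1)).1
  calc w ≤ (expTaylor t - 1 / 10 ^ 20) ^ 4 := hw
    _ ≤ Real.exp t ^ 4 := by
        gcongr
        linarith
    _ = Real.exp ((4 : ℕ) * t) := (Real.exp_nat_mul t 4).symm
    _ ≤ Real.exp (-(q * Real.log K)) := by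
        apply Real.exp_le_exp.2
        push_cast
        nlinarith
    _ = K⁻¹ ^ q := (inv_rpow_eq_exp hK q).symm

/-- Lower bounds for `10 ^ 22 * log (k + 3 / 2)`. -/
def logLower : Fin 6 → ℤ :=
  ![4054651081081643819779, 9162907318741550651833, 12527629684953679956877,
      15040773967762740733727, 17047480922384252346440, 18718021769015914266354]

/-- Upper bounds for `10 ^ 22 * log (k + 3 / 2)`. -/
def logUpper : Fin 6 → ℤ :=
  ![4054651081081643819782, 9162907318741550651839, 12527629684953679956886,
      15040773967762740733739, 17047480922384252346455, 18718021769015914266372]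

/-- Logarithms telescope: consecutive centers have ratio (1 + z)/(1 - z) with z = 1/(2k + 2), and z
= 1/5 gives the first center 3/2. -/
lemma log_center_bounds (k : Fin 6) :
    (logLower k : ℝ) / 10 ^ 22 ≤ Real.log ((2 * (k : ℝ) + 3) / 2) ∧
      Real.log ((2 * (k : ℝ) + 3) / 2) ≤ (logUpper k : ℝ) / 10 ^ 22 := by
  have b0 := log_bounds (z := 1 / 5) (lo := 4054651081081643819779 / 10 ^ 22)
    (hi := 4054651081081643819782 / 10 ^ 22) (by norm_num) (by norm_num) 18
    (by norm_num [Finset.sum_range_succ]) (by norm_num [Finset.sum_range_succ])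
  have b1 := log_bounds (z := 1 / 4) (lo := 5108256237659906832054 / 10 ^ 22)
    (hi := 5108256237659906832057 / 10 ^ 22) (by norm_num) (by norm_num) 18
    (by norm_num [Finset.sum_range_succ]) (by norm_num [Finset.sum_range_succ])
  have b2 := log_bounds (z := 1 / 6) (lo := 3364722366212129305044 / 10 ^ 22)
    (hi := 3364722366212129305047 / 10 ^ 22) (by norm_num) (by norm_num) 18
    (by norm_num [Finset.sum_range_succ]) (by norm_num [Finset.sum_range_succ])
  have b3 := log_bounds (z := 1 / 8) (lo := 2513144282809060776850 / 10 ^ 22)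
    (hi := 2513144282809060776853 / 10 ^ 22) (by norm_num) (by norm_num) 18
    (by norm_num [Finset.sum_range_succ]) (by norm_num [Finset.sum_range_succ])
  have b4 := log_bounds (z := 1 / 10) (lo := 2006706954621511612713 / 10 ^ 22)
    (hi := 2006706954621511612716 / 10 ^ 22) (by norm_num) (by norm_num) 18
    (by norm_num [Finset.sum_range_succ]) (by norm_num [Finset.sum_range_succ])
  have b5 := log_bounds (z := 1 / 12) (lo := 1670540846631661919914 / 10 ^ 22)
    (hi := 1670540846631661919917 / 10 ^ 22) (by norm_num) (by norm_num) 18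
    (by norm_num [Finset.sum_range_succ]) (by norm_num [Finset.sum_range_succ])
  have h0 : ((1 + 1 / 5) / (1 - 1 / 5) : ℝ) = 3 / 2 := by norm_num
  rw [h0] at b0
  have h1 : Real.log ((1 + 1 / 4) / (1 - 1 / 4)) = Real.log (5 / 2) - Real.log (3 / 2) := by
    rw [← Real.log_div (by norm_num) (by norm_num)]
    norm_num
  rw [h1] at b1
  have h2 : Real.log ((1 + 1 / 6) / (1 - 1 / 6)) = Real.log (7 / 2) - Real.log (5 / 2) := by
    rw [← Real.log_div (by norm_num) (by norm_num)]
    norm_num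
  rw [h2] at b2
  have h3 : Real.log ((1 + 1 / 8) / (1 - 1 / 8)) = Real.log (9 / 2) - Real.log (7 / 2) := by
    rw [← Real.log_div (by norm_num) (by norm_num)]
    norm_num
  rw [h3] at b3
  have h4 : Real.log ((1 + 1 / 10) / (1 - 1 / 10)) = Real.log (11 / 2) - Real.log (9 / 2) := by
    rw [← Real.log_div (by norm_num) (by norm_num)]
    norm_num
  rw [h4] at b4
  have h5 : Real.log ((1 + 1 / 12) / (1 - 1 / 12)) = Real.log (13 / 2) - Real.log (11 / 2) := by
    rw [← Real.log_div (by norm_num) (by norm_num)]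
    norm_num
  rw [h5] at b5
  fin_cases k <;> norm_num [logLower, logUpper] at * <;> constructor <;> linarith

/-- Bounds for `10 ^ 22 / 4` times the logarithms of the upper weights. -/
def exponentUpper : Fin 6 → ℤ :=
  ![-1758946509372870839313, -3974957036181790030304, -5434605854959762689651,
      -6524831937401891860682, -7395360651853979750322, -8120057285963294644809]

/-- Bounds for `10 ^ 22 / 4` times the logarithms of the lower weights. -/
def exponentLower : Fin 6 → ℤ :=
  ![-1758946509372465374207, -3974957036180873739576, -5434605854958509926687,
      -6524831937400387783291, -7395360651852275002237, -8120057285961422842641]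

lemma centerInv_eq (k : Fin 6) : centerInv k = ((2 * (k : ℝ) + 3) / 2)⁻¹ := by
  rw [centerInv, inv_div]

lemma le_upperWeight (k : Fin 6) :
    10 ^ 20 * centerInv k ^ ((17352383464805 : ℕ) / (10 ^ 13 : ℕ) : ℝ) ≤ upperWeight k := by
  have h : centerInv k ^ ((17352383464805 : ℕ) / (10 ^ 13 : ℕ) : ℝ) ≤ upperWeight k / 10 ^ 20 := by
    rw [centerInv_eq]
    refine inv_rpow_le (t := exponentUpper k / 10 ^ 22) (by positivity) (by positivity)
      (log_center_bounds k).1 ?_ ?_ ?_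
    · fin_cases k <;> norm_num [logLower, exponentUpper]
    · rw [abs_le]
      fin_cases k <;> norm_num [exponentUpper]
    · fin_cases k <;>
        norm_num [exponentUpper, upperWeight, expTaylor, Finset.sum_range_succ, Nat.factorial]
  rw [le_div_iff₀ (by positivity)] at h
  linarith

lemma lowerWeight_le (k : Fin 6) :
    lowerWeight k ≤ 10 ^ 20 * centerInv k ^ ((17352383464801 : ℕ) / (10 ^ 13 : ℕ) : ℝ) := by
  have h : lowerWeight k / 10 ^ 20 ≤ centerInv k ^ ((17352383464801 : ℕ) / (10 ^ 13 : ℕ) : ℝ) := by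
    rw [centerInv_eq]
    refine le_inv_rpow (t := exponentLower k / 10 ^ 22) (by positivity) (by positivity)
      (log_center_bounds k).2 ?_ ?_ ?_ ?_
    · fin_cases k <;> norm_num [logUpper, exponentLower]
    · rw [abs_le]
      fin_cases k <;> norm_num [exponentLower]
    · fin_cases k <;> norm_num [exponentLower, expTaylor, Finset.sum_range_succ, Nat.factorial]
    · fin_cases k <;>
        norm_num [exponentLower, lowerWeight, expTaylor, Finset.sum_range_succ, Nat.factorial]
  rw [div_le_iff₀ (by positivity)] at h
  linarith

end Weights

/-! ### Super- and subsolution at the two endpoints -/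

section Main

/-- The interval is [1/7, 7/8]; its right end determines the radius 3/8. -/
lemma mem_trapInterval_six {x : ℝ} (hx : x ∈ trapInterval 6) : |x - 1 / 2| ≤ 3 / 8 := by
  obtain ⟨h1, h2⟩ := hx
  norm_num at h1 h2
  rw [abs_le]
  constructor <;> linarith

lemma transfer_certPoly_eq (s : ℝ) {x : ℝ} (hx : x ∈ trapInterval 6) :
    transfer 6 s certPoly x = ∑ k : Fin 6, centerInv k ^ (2 * s) *
      branchTerm (fun j => (certCoeff j : ℝ)) 25 (2 * s) k (x - 1 / 2) := by
  refine Finset.sum_congr rfl fun k _ => ?_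
  have h := branch_rpow_mul_sum (fun j => (certCoeff j : ℝ)) 25 (2 * s) k (mem_trapInterval_six hx)
  rw [add_sub_cancel] at h
  rw [← h, certPoly]

/-- Nonnegativity allows c^(2s) to be replaced by one-sided rational weights term by term. -/
lemma branchTerm_certCoeff_nonneg (q : ℝ) (k : Fin 6) {x : ℝ} (hx : x ∈ trapInterval 6) :
    0 ≤ branchTerm (fun j => (certCoeff j : ℝ)) 25 q k (x - 1 / 2) := by
  have h := branch_rpow_mul_sum (fun j => (certCoeff j : ℝ)) 25 q k (mem_trapInterval_six hx)
  rw [add_sub_cancel] at h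
  have hb := branch_mem_trapInterval k hx
  have hb0 := trapInterval_pos hb
  obtain ⟨lo, hi, hlo, hP⟩ := certPoly_bounds
  have hP0 : 0 ≤ certPoly (branch k x) :=
    hlo.le.trans (hP _ ⟨hb0.le, (trapInterval_lt_one hb).le⟩).1
  refine nonneg_of_mul_nonneg_right (a := centerInv k ^ q) ?_
    (Real.rpow_pos_of_pos (centerInv_pos k) q)
  rw [← h]
  exact mul_nonneg (Real.rpow_nonneg hb0.le q) hP0

lemma transfer_certPoly_le {s : ℝ} (hs : 2 * s = (17352383464805 : ℕ) / (10 ^ 13 : ℕ)) {x : ℝ}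
    (hx : x ∈ trapInterval 6) : transfer 6 s certPoly x ≤ certPoly x := by
  have h := sum_branchTerm_le (by norm_num) (by norm_num) defect_upper.1 defect_upper.2
    (mem_trapInterval_six hx)
  rw [add_sub_cancel] at h
  refine le_of_mul_le_mul_left (h.trans' ?_) (by positivity : (0 : ℝ) < 10 ^ 20)
  rw [transfer_certPoly_eq s hx, hs, Finset.mul_sum]
  refine Finset.sum_le_sum fun k _ => ?_
  rw [← mul_assoc]
  exact mul_le_mul_of_nonneg_right (le_upperWeight k) (branchTerm_certCoeff_nonneg _ k hx)

lemma le_transfer_certPoly {s : ℝ} (hs : 2 * s = (17352383464801 : ℕ) / (10 ^ 13 : ℕ)) {x : ℝ}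
    (hx : x ∈ trapInterval 6) : certPoly x ≤ transfer 6 s certPoly x := by
  have h := le_sum_branchTerm (by norm_num) (by norm_num) defect_lower.1 defect_lower.2
    (mem_trapInterval_six hx)
  rw [add_sub_cancel] at h
  refine le_of_mul_le_mul_left (h.trans ?_) (by positivity : (0 : ℝ) < 10 ^ 20)
  rw [transfer_certPoly_eq s hx, hs, Finset.mul_sum]
  refine Finset.sum_le_sum fun k _ => ?_
  rw [← mul_assoc]
  exact mul_le_mul_of_nonneg_right (lowerWeight_le k) (branchTerm_certCoeff_nonneg _ k hx)

end Main

theorem mainTheorem9 :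
    dimH (cantorE 6) ∈ Set.Icc
        (ENNReal.ofReal (0.86761917324015 - (10 : ℝ) ^ (-13 : ℤ)))
        (ENNReal.ofReal (0.86761917324015 + (10 : ℝ) ^ (-13 : ℤ))) ∧
      ENNReal.ofReal (19 / 22) < dimH (cantorE 6) := by
  obtain ⟨lo, hi, hlo, hP⟩ := certPoly_bounds
  have hP' : ∀ x ∈ trapInterval 6, lo ≤ certPoly x ∧ certPoly x ≤ hi := fun x hx =>
    hP x ⟨(trapInterval_pos hx).le, (trapInterval_lt_one hx).le⟩
  have hl : ENNReal.ofReal (0.86761917324015 - (10 : ℝ) ^ (-13 : ℤ)) ≤ dimH (cantorE 6) := by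
    refine le_dimH_cantorE (by norm_num) hlo hP' fun x hx => le_transfer_certPoly ?_ hx
    rw [Real.coe_toNNReal _ (by norm_num)]
    norm_num
  have hu : dimH (cantorE 6) ≤ ENNReal.ofReal (0.86761917324015 + (10 : ℝ) ^ (-13 : ℤ)) := by
    refine dimH_cantorE_le hlo hP' fun x hx => transfer_certPoly_le ?_ hx
    rw [Real.coe_toNNReal _ (by norm_num)]
    norm_num
  refine ⟨⟨hl, hu⟩, lt_of_lt_of_le ?_ hl⟩
  rw [ENNReal.ofReal_lt_ofReal_iff (by norm_num)]
  norm_num
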